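/- **Path loss.** Let $L:[0,\infty)\to[0,\infty)$ be measurable and continuous at $0$, with $0<L_0:=L(0)<\infty$, $L(r)\le L_0$ for all $r$, and $0<\gamma:=\int_0^\infty rL(r)\,dr<\infty$. Assume further that there are $r_0\ge 0$, $\zeta>0$, $\lambda_c\ge 0$ and a differentiable non-increasing function $\tilde L:[r_0,\infty)\to(0,\infty)$ such that, for all $r\ge r_0$, $\tilde L(r)\le L(r)$ and $r\tilde L(r)\ge \zeta\,(-\tilde L'(r))$, and such that $\int_{r_0}^\infty \frac{r}{\tilde L(r)^2}e^{-\pi\lambda_0r^2}\,dr<\infty$ for every $\lambda_0>\lambda_c$. **Network.** Let the points $(x_i,t_i)_{i\in\mathbb N}$ form a Poisson point process of unit intensity on $\mathbb R^2\times[0,\infty)$. For $\lambda>0$, the base stations (BSs) of the network of density $\lambda$ are $\Phi_\lambda=\{x_i: t_i\le\lambda\}$, a homogeneous Poisson point process of density $\lambda$ on $\mathbb R^2$; as $\lambda$ grows, independent Poisson processes are superposed. In the network of density $\lambda$ each BS has $N_t(\lambda)\in\mathbb N$ antennas, where $N_t(\lambda)\to\infty$ as $\lambda\to\infty$. A single-antenna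 user at the origin is served by the closest BS, at distance $r_0(\lambda)=\min_{x\in\Phi_\lambda}\|x\|$. For $n$ antennas, the channel from the serving BS to the user is $h^{(n)}=(h_1,\dots,h_n)$, the first $n$ terms of one infinite sequence. The channel from an interfering BS $i$ to the user is $h_i^{(n)}\in\mathbb C^n$, and the channel from BS $i$ to the user that it serves itself is $w_i^{(n)}\in\mathbb C^n$. For each fixed $n$, the entries of $(h_a)_{a\ge1}$, $(h_i^{(n)})_i$, $(w_i^{(n)})_i$ are i.i.d. circularly symmetric complex Gaussian random variables with zero mean and unit variance (Rayleigh fading), independent of $(x_i,t_i)_i$. All BSs use maximum ratio transmission (MRT): the precoder for a channel row vector $h$ is $h^*/\|h\|_2$. Thus the gain of the serving link is $\left|h^{(n)}(h^{(n)})^*\right|^2/\|h^{(n)}\|_2^2$ and that of interferer $i$ is $g_i^{(n)}=\left|h_i^{(n)}(w_i^{(n)})^*\right|^2/\|w_i^{(n)}\|_2^2$. With noise variance $\sigma^2\ge 0$ and $n=N_t(\lambda)$, $$\mathrm{SINR}(\lambda)=\frac{L(r_0(\lambda))\,\left|h^{(n)}(h^{(n)})^*\right|^2/\|h^{(n)}\|_2^2}{\sum_{i:\,x_i\in\Phi_\lambda,\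 \|x_i\|>r_0(\lambda)}L(\|x_i\|)\,g_i^{(n)}+\sigma^2}.$$ **Theorem.** 1. If, in addition, each BS carries one interference gain, i.e. almost surely $g_i^{(n)}=g_i^{(1)}$ for all $i$ and all $n\ge1$, then almost surely $$\lim_{\lambda\to\infty}\frac{\lambda}{N_t(\lambda)}\,\mathrm{SINR}(\lambda)=\frac{L_0}{2\pi\gamma}.$$ 2. Without this additional condition, $\mathbb E[\mathrm{SINR}(\lambda)]$ is finite for all sufficiently large $\lambda$, and $$\lim_{\lambda\to\infty}\frac{\lambda}{N_t(\lambda)}\,\mathbb E[\mathrm{SINR}(\lambda)]=\frac{L_0}{2\pi\gamma}.$$ -/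

import Mathlib

open MeasureTheory ProbabilityTheory Filter Topology Set
open scoped NNReal ENNReal

noncomputable section

/-- The Euclidean plane, in which the base stations (BSs) are located. -/
abbrev Plane : Type := EuclideanSpace ℝ (Fin 2)

/-! ### Path loss -/

/-- Physically feasible large-scale channel gain `L : [0, ∞) → [0, ∞)` (only the values of `L` on
`[0, ∞)` matter): `L 0` is non-zero, `L r ≤ L 0`, and `γ = ∫ r L(r) dr` is finite and non-zero.
`L` is measurable, and continuous at the origin (so that `L 0` is the gain seen at vanishing
distance). -/
structure PhysicallyFeasible (L : ℝ → ℝ) : Prop where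
  measurable : Measurable L
  nonneg : ∀ r, 0 ≤ r → 0 ≤ L r
  zero_pos : 0 < L 0
  le_zero : ∀ r, 0 ≤ r → L r ≤ L 0
  integrable : IntegrableOn (fun r => r * L r) (Ioi 0)
  integral_pos : 0 < ∫ r in Ioi (0 : ℝ), r * L r
  continuous_zero : ContinuousWithinAt L (Ici 0) 0

/-- The constant `γ = ∫₀^∞ r L(r) dr`. -/
def pathLossGamma (L : ℝ → ℝ) : ℝ := ∫ r in Ioi (0 : ℝ), r * L r

/-- The tail assumption on the path loss: on some `[r₀, ∞)` the gain `L` dominates a positive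
differentiable decreasing function `M` with `r M(r) / (-M'(r)) ≥ ζ > 0` (written without the
division, so that `M'(r) = 0` is allowed) and with `∫_{r₀}^∞ r M(r)⁻² exp(-π λ₀ r²) dr` finite
for all `λ₀` above some `λ_c`. -/
def PathLossTail (L : ℝ → ℝ) : Prop :=
  ∃ (r₀ : ℝ) (ζ : ℝ) (M : ℝ → ℝ), 0 ≤ r₀ ∧ 0 < ζ ∧
    DifferentiableOn ℝ M (Ici r₀) ∧ AntitoneOn M (Ici r₀) ∧ (∀ r ∈ Ici r₀, 0 < M r) ∧
    (∀ r ∈ Ici r₀, M r ≤ L r) ∧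
    (∀ r ∈ Ici r₀, ζ * (-derivWithin M (Ici r₀) r) ≤ r * M r) ∧
    ∃ lamC : ℝ, 0 ≤ lamC ∧ ∀ lam₀ : ℝ, lamC < lam₀ →
      IntegrableOn (fun r => r / M r ^ 2 * Real.exp (-Real.pi * lam₀ * r ^ 2)) (Ici r₀)

/-! ### Poisson point processes and Rayleigh fading -/

/-- The number of points of the sequence `z` that lie in `A`. -/
def pointCount {S : Type*} (z : ℕ → S) (A : Set S) : ℕ∞ := {i : ℕ | z i ∈ A}.encard

/-- The random points `Z 0, Z 1, …` enumerate a Poisson point process with intensity measure `ν`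
(a measure of infinite total mass): counts in sets of finite `ν`-measure are Poisson distributed,
and counts in pairwise disjoint sets are independent. -/
structure IsPoissonPointProcess {Ω S : Type*} [MeasurableSpace Ω] [MeasurableSpace S]
    (P : Measure Ω) (Z : ℕ → Ω → S) (ν : Measure S) : Prop where
  measurable : ∀ i, Measurable (Z i)
  hasLaw_count : ∀ A : Set S, MeasurableSet A → ν A ≠ ∞ →
    HasLaw (fun ω => pointCount (fun i => Z i ω) A)
      ((poissonMeasure (ν A).toNNReal).map (fun k : ℕ => (k : ℕ∞))) P
  indep_count : ∀ (m : ℕ) (A : Fin m → Set S), (∀ j, MeasurableSet (A j)) →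
    (∀ j, ν (A j) ≠ ∞) → Pairwise (fun j k => Disjoint (A j) (A k)) →
    iIndepFun (fun j ω => pointCount (fun i => Z i ω) (A j)) P

/-- The circularly symmetric complex Gaussian law with zero mean and unit variance: independent
real and imaginary parts, each `N(0, 1/2)`. -/
def complexGaussian : Measure ℂ :=
  ((gaussianReal 0 (1 / 2)).prod (gaussianReal 0 (1 / 2))).map (fun p => (⟨p.1, p.2⟩ : ℂ))

/-! ### Maximum ratio transmission -/

/-- The maximum ratio transmission precoder `h* / ‖h‖` for the channel row vector `h`, with `‖h‖`
the Euclidean norm. -/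
def mrtPrecoder {n : ℕ} (h : Fin n → ℂ) (a : Fin n) : ℂ :=
  (starRingEnd ℂ) (h a) / (Real.sqrt (∑ b, ‖h b‖ ^ 2) : ℂ)

/-- The received power gain `|h v|²` when the channel is `h` and the precoder is `v`. -/
def beamGain {n : ℕ} (h v : Fin n → ℂ) : ℝ := ‖∑ a, h a * v a‖ ^ 2

/-! ### The MISO network -/

/-- Downlink MISO networks of all BS densities on one probability space, seen from a
single-antenna user at the origin.

BS `i` is located at `pos i` and has a level `level i ≥ 0`; the locations and levels together form
a Poisson point process on `ℝ² × [0, ∞)` with Lebesgue intensity. The BSs of the network of density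
`lam` are those with level at most `lam`: they form a homogeneous Poisson process of density `lam`
in the plane, and the network of density `lam + lam'` is the superposition of the one of density
`lam` and an independent homogeneous Poisson process of density `lam'`.

The fading coefficients are
* `serv a`: from antenna `a` of the serving BS to the user at the origin;
* `cross n i a`: from antenna `a` of BS `i`, interfering, to the user at the origin, when each BS
  has `n` antennas;
* `own n i a`: from antenna `a` of BS `i` to the user that BS `i` itself serves, when each BS has
  `n` antennas.

For each number `n` of antennas they are i.i.d. standard complex Gaussian, and independent of the
locations. Nothing is said about the joint law of `cross n`, `own n` for different `n`. -/
structure MISONetwork {Ω : Type*} [MeasurableSpace Ω] (P : Measure Ω) where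
  pos : ℕ → Ω → Plane
  level : ℕ → Ω → ℝ
  serv : ℕ → Ω → ℂ
  cross : (n : ℕ) → ℕ → Fin n → Ω → ℂ
  own : (n : ℕ) → ℕ → Fin n → Ω → ℂ
  poisson : IsPoissonPointProcess P (fun i ω => (pos i ω, level i ω))
    ((volume : Measure Plane).prod ((volume : Measure ℝ).restrict (Ici 0)))
  serv_law : ∀ a, HasLaw (serv a) complexGaussian P
  cross_law : ∀ n i a, HasLaw (cross n i a) complexGaussian P
  own_law : ∀ n i a, HasLaw (own n i a) complexGaussian P
  indep_fading : ∀ n : ℕ, iIndepFun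
    (Sum.elim serv (Sum.elim (fun p : ℕ × Fin n => cross n p.1 p.2)
      (fun p : ℕ × Fin n => own n p.1 p.2))) P
  indep_locations : ∀ n : ℕ, IndepFun (fun ω i => (pos i ω, level i ω))
    (fun ω c => Sum.elim serv (Sum.elim (fun p : ℕ × Fin n => cross n p.1 p.2)
      (fun p : ℕ × Fin n => own n p.1 p.2)) c ω) P

namespace MISONetwork

variable {Ω : Type*} [MeasurableSpace Ω] {P : Measure Ω}

/-- The serving distance: the distance from the origin to the closest BS of the network of
density `lam`. -/
def servingDist (X : MISONetwork P) (lam : ℝ) (ω : Ω) : ℝ :=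
  sInf {r : ℝ | ∃ i, X.level i ω ≤ lam ∧ r = ‖X.pos i ω‖}

/-- The gain of the serving link with `n` transmit antennas; the serving BS uses maximum ratio
transmission for the channel to the user at the origin. -/
def servGain (X : MISONetwork P) (n : ℕ) (ω : Ω) : ℝ :=
  beamGain (fun a : Fin n => X.serv a ω) (mrtPrecoder (fun a : Fin n => X.serv a ω))

/-- The small-scale gain from the interfering BS `i` with `n` transmit antennas to the user at the
origin; BS `i` uses maximum ratio transmission for the channel to its own user. -/
def crossGain (X : MISONetwork P) (n i : ℕ) (ω : Ω) : ℝ :=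
  beamGain (fun a => X.cross n i a ω) (mrtPrecoder (fun a => X.own n i a ω))

open Classical in
/-- The interference at the origin: the sum over all BSs of the network of density `lam` that are
farther than the serving distance. -/
def interference (X : MISONetwork P) (L : ℝ → ℝ) (n : ℕ) (lam : ℝ) (ω : Ω) : ℝ :=
  ∑' i, if X.level i ω ≤ lam ∧ X.servingDist lam ω < ‖X.pos i ω‖ then
    L ‖X.pos i ω‖ * X.crossGain n i ω else 0

/-- The conditional SINR of the user at the origin in the network of density `lam` with `Nt lam`
transmit antennas per BS and noise variance `noise`. -/
def sinr (X : MISONetwork P) (L : ℝ → ℝ) (Nt : ℝ → ℕ) (noise : ℝ) (lam : ℝ) (ω : Ω) : ℝ :=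
  L (X.servingDist lam ω) * X.servGain (Nt lam) ω /
    (X.interference L (Nt lam) lam ω + noise)

/-- Each interfering BS `i` carries one small-scale gain `g i`, whatever the density of the network
(and hence the number of antennas per BS) is. -/
def FixedInterfererGains (X : MISONetwork P) : Prop :=
  ∀ᵐ ω ∂P, ∀ n i : ℕ, 1 ≤ n → X.crossGain n i ω = X.crossGain 1 i ω

end MISONetwork

end

/-! Three facts give the limit. The serving gain under MRT is the squared norm of the channel, a sum
of `n` i.i.d. terms of mean one, so it is asymptotic to `n` by the strong law
(`ae_tendsto_servGain_div`). The nearest BS tends to the origin, so its path loss tends to `L 0`.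
The interference divided by `lam` tends to the integral of `L ‖x‖` over the plane, which is `2πγ`.

For the third fact, unitary invariance of the Gaussian vector makes each interfering gain unit
exponential, whatever the number of antennas (`isExpMarking`). Interference is thus a sum over a
Poisson process with independent exponential marks. Campbell's first and second moment formulas give
its mean and a variance bound of order `lam`. After division by `lam` the variance is `O(1/lam)`,
which yields almost sure convergence along any sequence with summable reciprocals
(`ae_tendsto_levelSum_div`). The exclusion of the nearest BS is harmless: the interference lies
between the sum over all points and the sum over points at distance at least `ε`
(`tendsto_mul_lossRatio`).

With one gain per BS the sum over all points is monotone in the density, so convergence along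
squares extends to all densities. Without this condition nothing links the gains for different
antenna numbers, and only sequential almost sure convergence is available. Every sequence of
densities tending to infinity has a subsequence with summable reciprocals, which suffices for
expectations once uniform integrability is known. The serving gain is independent of the remaining
ratio and has mean exactly `n`, so only that ratio matters.

Uniform integrability comes from `E[I⁻²] = O(lam⁻²)` for the interference `I`
(`exists_lintegral_inv_sq_totalInterference_le`), the delicate step. The tail assumption forces a
Gaussian lower bound on `L`, which is geometric along annuli of equal area. The probability that the
first `2m` such annuli fail to supply about `lam` interferers decays like `exp(-const * lam * m)`,
and for large `lam` this beats the geometric loss of signal strength. Given enough interferers, the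
inverse second moment of a sum of exponential marks is explicit. -/

noncomputable section

/-! ### Poisson moments -/

theorem lintegral_poissonMeasure (r : ℝ≥0) (f : ℕ → ℝ≥0∞) :
    ∫⁻ n, f n ∂(poissonMeasure r) =
      ∑' n, ENNReal.ofReal (Real.exp (-r) * r ^ n / n.factorial) * f n := by
  rw [poissonMeasure, lintegral_sum_measure]
  simp [lintegral_smul_measure, lintegral_dirac]

theorem lintegral_cast_poissonMeasure (r : ℝ≥0) :
    ∫⁻ n, (n : ℝ≥0∞) ∂(poissonMeasure r) = r := by
  rw [lintegral_poissonMeasure, tsum_eq_zero_add' ENNReal.summable]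
  have h : ∀ n : ℕ, ENNReal.ofReal (Real.exp (-r) * r ^ (n + 1) / (n + 1).factorial) *
      ((n + 1 : ℕ) : ℝ≥0∞) = r * ENNReal.ofReal (Real.exp (-r) * r ^ n / n.factorial) := by
    intro n
    rw [← ENNReal.ofReal_natCast, ← ENNReal.ofReal_mul (by positivity), ← ENNReal.ofReal_coe_nnreal,
      ← ENNReal.ofReal_mul (by positivity)]
    congr 1
    rw [Nat.factorial_succ]
    push_cast
    field_simp
    ring
  simp_rw [h, ENNReal.tsum_mul_left]
  have := lintegral_poissonMeasure r (fun _ => 1)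
  simp only [lintegral_one, measure_univ, mul_one] at this
  simp [← this]

theorem lintegral_cast_sq_poissonMeasure (r : ℝ≥0) :
    ∫⁻ n, (n : ℝ≥0∞) * n ∂(poissonMeasure r) = r * r + r := by
  rw [lintegral_poissonMeasure, tsum_eq_zero_add' ENNReal.summable]
  have h : ∀ n : ℕ, ENNReal.ofReal (Real.exp (-r) * r ^ (n + 1) / (n + 1).factorial) *
      (((n + 1 : ℕ) : ℝ≥0∞) * ((n + 1 : ℕ) : ℝ≥0∞)) =
      r * (ENNReal.ofReal (Real.exp (-r) * r ^ n / n.factorial) * n +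
        ENNReal.ofReal (Real.exp (-r) * r ^ n / n.factorial) * 1) := by
    intro n
    rw [← mul_add, ← Nat.cast_one (R := ℝ≥0∞), ← Nat.cast_add]
    simp only [← ENNReal.ofReal_natCast]
    rw [← ENNReal.ofReal_mul (by positivity), ← ENNReal.ofReal_mul (by positivity),
      ← ENNReal.ofReal_coe_nnreal, ← ENNReal.ofReal_mul (by positivity),
      ← ENNReal.ofReal_mul (by positivity)]
    congr 1
    rw [Nat.factorial_succ]
    push_cast
    field_simp
    ring
  simp_rw [h, ENNReal.tsum_mul_left, ENNReal.tsum_add, ← lintegral_poissonMeasure]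
  rw [lintegral_cast_poissonMeasure]
  simp [mul_add]

theorem lintegral_half_pow_poissonMeasure (r : ℝ≥0) :
    ∫⁻ n, ENNReal.ofReal ((1 / 2) ^ n) ∂(poissonMeasure r) =
      ENNReal.ofReal (Real.exp (-(r / 2))) := by
  rw [lintegral_poissonMeasure]
  have h : ∀ n : ℕ, ENNReal.ofReal (Real.exp (-r) * r ^ n / n.factorial) *
      ENNReal.ofReal ((1 / 2) ^ n) =
      ENNReal.ofReal (Real.exp (-(r / 2))) * ENNReal.ofReal
        (Real.exp (-(r / 2 : ℝ≥0)) * (r / 2 : ℝ≥0) ^ n / n.factorial) := by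
    intro n
    rw [← ENNReal.ofReal_mul (by positivity), ← ENNReal.ofReal_mul (by positivity)]
    congr 1
    have : Real.exp (-(r : ℝ)) = Real.exp (-(r / 2)) * Real.exp (-(r / 2)) := by
      rw [← Real.exp_add]; ring_nf
    rw [this]
    push_cast
    rw [div_pow, div_pow]
    field_simp
    ring
  simp_rw [h, ENNReal.tsum_mul_left]
  have := lintegral_poissonMeasure (r / 2) (fun _ => 1)
  simp only [lintegral_one, measure_univ, mul_one] at this
  rw [← this, mul_one]

/-- Chernoff bound with base `1/2`: Markov's inequality for `2⁻ᴺ`, whose mean is `exp(-r/2)`. Since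
`2⁻ᴷ ≥ exp(-K) ≥ exp(-r/4)`, half of the exponent survives. -/
theorem poissonMeasure_Iio_le (r : ℝ≥0) {K : ℕ} (hK : (K : ℝ) ≤ r / 4) :
    poissonMeasure r {n | n < K} ≤ ENNReal.ofReal (Real.exp (-(r / 4))) := by
  have h1 : (ENNReal.ofReal ((1 / 2) ^ K)) * poissonMeasure r {n | n < K} ≤
      ENNReal.ofReal (Real.exp (-(r / 2))) := by
    rw [← lintegral_half_pow_poissonMeasure]
    refine le_trans ?_ (mul_meas_ge_le_lintegral₀ (by fun_prop) (ENNReal.ofReal ((1 / 2) ^ K)))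
    refine mul_le_mul_right (measure_mono fun n hn => ?_) _
    exact ENNReal.ofReal_le_ofReal (pow_le_pow_of_le_one (by norm_num) (by norm_num) (le_of_lt hn))
  have h2 : Real.exp (-(r / 2)) ≤ (1 / 2) ^ K * Real.exp (-(r / 4)) := by
    have h3 : Real.exp (-(r / 4)) ≤ (1 / 2) ^ K := by
      calc Real.exp (-(r / 4)) ≤ Real.exp (-K) := by
            apply Real.exp_le_exp.2; linarith
        _ = (Real.exp (-1)) ^ K := by rw [← Real.exp_nat_mul]; ring_nf
        _ ≤ (1 / 2) ^ K := by
            gcongr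
            rw [Real.exp_neg, one_div]
            have := Real.add_one_le_exp 1
            exact inv_anti₀ (by norm_num) (by linarith)
    have h4 : Real.exp (-((r : ℝ) / 2)) = Real.exp (-(r / 4)) * Real.exp (-(r / 4)) := by
      rw [← Real.exp_add]; ring_nf
    rw [h4]
    gcongr
  have h5 : ENNReal.ofReal ((1 / 2) ^ K) ≠ 0 := by
    simp
  rw [← ENNReal.mul_le_mul_iff_right h5 ENNReal.ofReal_ne_top]
  refine h1.trans ?_
  rw [← ENNReal.ofReal_mul (by positivity)]
  exact ENNReal.ofReal_le_ofReal h2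

/-! ### Campbell's formulas -/

section Campbell

theorem pointCount_eq_tsum {S : Type*} (z : ℕ → S) (A : Set S) :
    ((pointCount z A : ℕ∞) : ℝ≥0∞) = ∑' i, A.indicator (fun _ => 1) (z i) := by
  rw [pointCount, ← ENNReal.tsum_set_one, tsum_subtype {i | z i ∈ A} (fun _ => (1 : ℝ≥0∞))]
  rfl

theorem le_pointCount_iff {S : Type*} (z : ℕ → S) (A : Set S) (K : ℕ) :
    (K : ℕ∞) ≤ pointCount z A ↔ ∃ s : Finset ℕ, s.card = K ∧ ∀ i ∈ s, z i ∈ A := by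
  constructor
  · intro h
    obtain ⟨t, ht, htK⟩ := Set.exists_subset_encard_eq h
    have hfin : t.Finite := Set.finite_of_encard_eq_coe htK
    refine ⟨hfin.toFinset, ?_, fun i hi => ht (by simpa using hi)⟩
    rw [hfin.encard_eq_coe_toFinset_card] at htK
    exact_mod_cast htK
  · rintro ⟨s, rfl, hs⟩
    rw [← Set.encard_coe_eq_coe_finsetCard]
    exact Set.encard_le_encard (fun i hi => hs i hi)

variable {Ω S : Type*} [MeasurableSpace Ω] [MeasurableSpace S] {P : Measure Ω}
  {Z : ℕ → Ω → S} {ν : Measure S}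

theorem measurable_pointCount (hZ : ∀ i, Measurable (Z i)) {A : Set S} (hA : MeasurableSet A) :
    Measurable (fun ω => ((pointCount (fun i => Z i ω) A : ℕ∞) : ℝ≥0∞)) := by
  simp_rw [pointCount_eq_tsum]
  exact Measurable.tsum fun i => (measurable_const.indicator hA).comp (hZ i)

namespace IsPoissonPointProcess

variable (hP : IsPoissonPointProcess P Z ν)
include hP

theorem lintegral_comp_pointCount {A : Set S} (hA : MeasurableSet A) (hνA : ν A ≠ ∞)
    (f : ℕ∞ → ℝ≥0∞) :
    ∫⁻ ω, f (pointCount (fun i => Z i ω) A) ∂P =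
      ∫⁻ n, f n ∂(poissonMeasure (ν A).toNNReal) := by
  rw [(hP.hasLaw_count A hA hνA).lintegral_comp (f := f) (Measurable.of_discrete).aemeasurable,
    lintegral_map Measurable.of_discrete Measurable.of_discrete]

theorem lintegral_pointCount {A : Set S} (hA : MeasurableSet A) (hνA : ν A ≠ ∞) :
    ∫⁻ ω, (pointCount (fun i => Z i ω) A : ℝ≥0∞) ∂P = ν A := by
  rw [hP.lintegral_comp_pointCount hA hνA (fun k => (k : ℝ≥0∞))]
  simp only [ENat.toENNReal_coe, lintegral_cast_poissonMeasure]
  exact ENNReal.coe_toNNReal hνA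

theorem lintegral_pointCount_sq {A : Set S} (hA : MeasurableSet A) (hνA : ν A ≠ ∞) :
    ∫⁻ ω, (pointCount (fun i => Z i ω) A : ℝ≥0∞) * (pointCount (fun i => Z i ω) A : ℝ≥0∞) ∂P =
      ν A * ν A + ν A := by
  rw [hP.lintegral_comp_pointCount hA hνA (fun k => (k : ℝ≥0∞) * (k : ℝ≥0∞))]
  simp only [ENat.toENNReal_coe, lintegral_cast_sq_poissonMeasure]
  rw [ENNReal.coe_toNNReal hνA]

theorem measure_pointCount_lt {A : Set S} (hA : MeasurableSet A) (hνA : ν A ≠ ∞) {K : ℕ}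
    (hK : (K : ℝ) ≤ (ν A).toReal / 4) :
    P {ω | pointCount (fun i => Z i ω) A < K} ≤
      ENNReal.ofReal (Real.exp (-((ν A).toReal / 4))) := by
  have h := (hP.hasLaw_count A hA hνA).measure_eq (p := fun k => k < (K : ℕ∞))
    (MeasurableSet.of_discrete)
  rw [h, Measure.map_apply Measurable.of_discrete MeasurableSet.of_discrete]
  have := poissonMeasure_Iio_le (ν A).toNNReal (K := K) hK
  convert this using 2
  · ext n
    simp
  · rfl

theorem lintegral_pointCount_mul_of_disjoint {A B : Set S} (hA : MeasurableSet A)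
    (hB : MeasurableSet B) (hνA : ν A ≠ ∞) (hνB : ν B ≠ ∞) (hAB : Disjoint A B) :
    ∫⁻ ω, (pointCount (fun i => Z i ω) A : ℝ≥0∞) * (pointCount (fun i => Z i ω) B : ℝ≥0∞) ∂P =
      ν A * ν B := by
  have hi := hP.indep_count 2 ![A, B] (by simp [Fin.forall_fin_two, hA, hB])
    (by simp [Fin.forall_fin_two, hνA, hνB])
    (by
      intro i j hij
      fin_cases i <;> fin_cases j <;> simp_all [disjoint_comm])
  have h01 := (hi.indepFun (i := 0) (j := 1) (by simp)).comp
    (φ := fun k : ℕ∞ => (k : ℝ≥0∞)) (ψ := fun k : ℕ∞ => (k : ℝ≥0∞))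
    Measurable.of_discrete Measurable.of_discrete
  have := lintegral_mul_eq_lintegral_mul_lintegral_of_indepFun
    (measurable_pointCount hP.measurable hA) (measurable_pointCount hP.measurable hB) h01
  rw [hP.lintegral_pointCount hA hνA, hP.lintegral_pointCount hB hνB] at this
  exact this

/-- Splitting into `A ∩ B`, `A \ B` and `B \ A` leaves products of independent counts and one
square; the extra `ν (A ∩ B)` is the Poisson variance in that square. -/
theorem lintegral_pointCount_mul {A B : Set S} (hA : MeasurableSet A)
    (hB : MeasurableSet B) (hνA : ν A ≠ ∞) (hνB : ν B ≠ ∞) :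
    ∫⁻ ω, (pointCount (fun i => Z i ω) A : ℝ≥0∞) * (pointCount (fun i => Z i ω) B : ℝ≥0∞) ∂P =
      ν A * ν B + ν (A ∩ B) := by
  have hadd : ∀ (C D : Set S), Disjoint C D → ∀ z : ℕ → S,
      ((pointCount z (C ∪ D) : ℕ∞) : ℝ≥0∞) = pointCount z C + pointCount z D := by
    intro C D hCD z
    simp_rw [pointCount_eq_tsum, ← ENNReal.tsum_add]
    congr with i
    rw [Set.indicator_union_of_disjoint hCD]
  have hm {C : Set S} (hC : MeasurableSet C) := measurable_pointCount hP.measurable hC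
  have f1 : ν (A ∩ B) ≠ ∞ := measure_ne_top_of_subset inter_subset_left hνA
  have f2 : ν (A \ B) ≠ ∞ := measure_ne_top_of_subset sdiff_subset hνA
  have f3 : ν (B \ A) ≠ ∞ := measure_ne_top_of_subset sdiff_subset hνB
  have eA : A = (A ∩ B) ∪ (A \ B) := (inter_union_sdiff A B).symm
  have eB : B = (A ∩ B) ∪ (B \ A) := by rw [inter_comm]; exact (inter_union_sdiff B A).symm
  have d1 : Disjoint (A ∩ B) (A \ B) := disjoint_sdiff_inter.symm
  have d2 : Disjoint (A ∩ B) (B \ A) := by rw [inter_comm]; exact disjoint_sdiff_inter.symm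
  have d3 : Disjoint (A \ B) (B \ A) := disjoint_sdiff_sdiff
  have hνA' : ν A = ν (A ∩ B) + ν (A \ B) := (measure_inter_add_sdiff A hB).symm
  have hνB' : ν B = ν (A ∩ B) + ν (B \ A) := by
    rw [inter_comm]; exact (measure_inter_add_sdiff B hA).symm
  have key : ∀ ω, (pointCount (fun i => Z i ω) A : ℝ≥0∞) * (pointCount (fun i => Z i ω) B : ℝ≥0∞)
      = (pointCount (fun i => Z i ω) (A ∩ B) : ℝ≥0∞) * (pointCount (fun i => Z i ω) (A ∩ B) : ℝ≥0∞)
      + (pointCount (fun i => Z i ω) (A ∩ B) : ℝ≥0∞) * (pointCount (fun i => Z i ω) (B \ A) : ℝ≥0∞)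
      + (pointCount (fun i => Z i ω) (A ∩ B) : ℝ≥0∞) * (pointCount (fun i => Z i ω) (A \ B) : ℝ≥0∞)
      + (pointCount (fun i => Z i ω) (A \ B) : ℝ≥0∞) * (pointCount (fun i => Z i ω) (B \ A) : ℝ≥0∞)
      := by
    intro ω
    have h1 := hadd _ _ d1 (fun i => Z i ω)
    have h2 := hadd _ _ d2 (fun i => Z i ω)
    rw [← eA] at h1
    rw [← eB] at h2
    rw [h1, h2]
    ring
  simp_rw [key]
  have mi := hm (hA.inter hB)
  have ma := hm (hA.diff hB)
  have mb := hm (hB.diff hA)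
  rw [lintegral_add_right _ (by fun_prop), lintegral_add_right _ (by fun_prop),
    lintegral_add_right _ (by fun_prop), hP.lintegral_pointCount_sq (hA.inter hB) f1,
    hP.lintegral_pointCount_mul_of_disjoint (hA.inter hB) (hB.diff hA) f1 f3 d2,
    hP.lintegral_pointCount_mul_of_disjoint (hA.inter hB) (hA.diff hB) f1 f2 d1,
    hP.lintegral_pointCount_mul_of_disjoint (hA.diff hB) (hB.diff hA) f2 f3 d3, hνA', hνB']
  ring

omit hP in
-- The Poisson axioms only speak of sets of finite intensity. Exhausting by spanning sets of `ν`
-- removes that restriction, with no finiteness required of `μ` or `μ'`.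
theorem measure_ext_of_forall_ne_top [SigmaFinite ν] {μ μ' : Measure S}
    (h : ∀ A, MeasurableSet A → ν A ≠ ∞ → μ A = μ' A) : μ = μ' := by
  ext A hA
  have hm : Monotone fun n => A ∩ spanningSets ν n :=
    fun i j hij => inter_subset_inter_right _ (monotone_spanningSets ν hij)
  have hU : A = ⋃ n, A ∩ spanningSets ν n := by
    rw [← inter_iUnion, iUnion_spanningSets, inter_univ]
  rw [hU, hm.measure_iUnion, hm.measure_iUnion]
  congr with n
  exact h _ (hA.inter (measurableSet_spanningSets ν n))
    (measure_ne_top_of_subset inter_subset_right (measure_spanningSets_lt_top ν n).ne)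

omit hP in
-- The left side is linear in `f`, so it is integration against a single measure. Campbell
-- identities thereby reduce to identifying that measure on sets.
theorem lintegral_tsum_weighted (hZ : ∀ i, Measurable (Z i)) {w : Ω → ℝ≥0∞} (hw : Measurable w)
    {f : S → ℝ≥0∞} (hf : Measurable f) :
    ∫⁻ ω, w ω * ∑' i, f (Z i ω) ∂P =
      ∫⁻ x, f x ∂(Measure.sum fun i => (P.withDensity w).map (Z i)) := by
  rw [lintegral_sum_measure]
  simp_rw [lintegral_map hf (hZ _)]
  rw [← MeasureTheory.lintegral_tsum (f := fun i ω => f (Z i ω)) (fun i => (hf.comp (hZ i)).aemeasurable),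
    lintegral_withDensity_eq_lintegral_mul _ hw (g := fun ω => ∑' i, f (Z i ω))
      (Measurable.tsum fun i => hf.comp (hZ i))]
  rfl

/-- Campbell's formula. -/
theorem lintegral_tsum [SigmaFinite ν] {f : S → ℝ≥0∞} (hf : Measurable f) :
    ∫⁻ ω, ∑' i, f (Z i ω) ∂P = ∫⁻ x, f x ∂ν := by
  have key : (Measure.sum fun i => (P.withDensity 1).map (Z i)) = ν := by
    refine measure_ext_of_forall_ne_top (ν := ν) fun A hA hνA => ?_
    have := lintegral_tsum_weighted (P := P) hP.measurable (w := 1) measurable_one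
      (f := A.indicator fun _ => 1) (measurable_const.indicator hA)
    rw [lintegral_indicator hA, setLIntegral_one] at this
    rw [← this, ← hP.lintegral_pointCount hA hνA]
    simp [pointCount_eq_tsum]
  have := lintegral_tsum_weighted (P := P) hP.measurable (w := 1) measurable_one hf
  rw [key] at this
  simpa using this

/-- Campbell's formula for the second moment measure. -/
theorem lintegral_tsum_mul_tsum [SigmaFinite ν] {f g : S → ℝ≥0∞} (hf : Measurable f)
    (hg : Measurable g) :
    ∫⁻ ω, (∑' i, f (Z i ω)) * ∑' i, g (Z i ω) ∂P =
      (∫⁻ x, f x ∂ν) * (∫⁻ x, g x ∂ν) + ∫⁻ x, f x * g x ∂ν := by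
  have hmt {f : S → ℝ≥0∞} (hf : Measurable f) : Measurable fun ω => ∑' i, f (Z i ω) :=
    Measurable.tsum fun i => hf.comp (hP.measurable i)
  -- The bilinear identity is extended from indicators to functions one factor at a time: first with
  -- a point count as the weight, then with the general sum as the weight.
  have step1 : ∀ B, MeasurableSet B → ν B ≠ ∞ → ∀ f : S → ℝ≥0∞, Measurable f →
      ∫⁻ ω, (pointCount (fun i => Z i ω) B : ℝ≥0∞) * ∑' i, f (Z i ω) ∂P =
        ν B * (∫⁻ x, f x ∂ν) + ∫⁻ x in B, f x ∂ν := by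
    intro B hB hνB f hf
    have key : (Measure.sum fun i => (P.withDensity
        fun ω => (pointCount (fun i => Z i ω) B : ℝ≥0∞)).map (Z i)) = ν B • ν + ν.restrict B := by
      refine measure_ext_of_forall_ne_top (ν := ν) fun A hA hνA => ?_
      have := lintegral_tsum_weighted (P := P) hP.measurable
        (measurable_pointCount hP.measurable hB)
        (f := A.indicator fun _ => 1) (measurable_const.indicator hA)
      rw [lintegral_indicator hA, setLIntegral_one] at this
      simp_rw [← pointCount_eq_tsum] at this
      rw [← this, hP.lintegral_pointCount_mul hB hA hνB hνA, inter_comm]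
      simp [Measure.restrict_apply hA]
    rw [lintegral_tsum_weighted hP.measurable (measurable_pointCount hP.measurable hB) hf, key,
      lintegral_add_measure, lintegral_smul_measure, smul_eq_mul]
  have key : (Measure.sum fun i => (P.withDensity fun ω => ∑' i, f (Z i ω)).map (Z i)) =
      (∫⁻ x, f x ∂ν) • ν + ν.withDensity f := by
    refine measure_ext_of_forall_ne_top (ν := ν) fun A hA hνA => ?_
    have := lintegral_tsum_weighted (P := P) hP.measurable (hmt hf)
      (f := A.indicator fun _ => 1) (measurable_const.indicator hA)
    rw [lintegral_indicator hA, setLIntegral_one] at this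
    simp_rw [← pointCount_eq_tsum, mul_comm _ ((pointCount _ _ : ℕ∞) : ℝ≥0∞)] at this
    rw [← this, step1 A hA hνA f hf, Measure.add_apply, withDensity_apply _ hA]
    simp [mul_comm]
  rw [lintegral_tsum_weighted hP.measurable (hmt hf) hg, key,
    lintegral_add_measure, lintegral_smul_measure, smul_eq_mul,
    lintegral_withDensity_eq_lintegral_mul _ hf hg]
  rfl

end IsPoissonPointProcess

end Campbell

/-! ### Point processes marked by unit exponential gains -/

/-- The marks `g` are nonnegative, i.i.d. with the Laplace transform and the mean of the unit
exponential law, and independent of the points `Z`. -/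
structure IsExpMarking {Ω S : Type*} [MeasurableSpace Ω] [MeasurableSpace S] (P : Measure Ω)
    (Z : ℕ → Ω → S) (g : ℕ → Ω → ℝ) : Prop where
  measurable : ∀ i, Measurable (g i)
  nonneg : ∀ i ω, 0 ≤ g i ω
  indep_marks : iIndepFun g P
  indep_points : IndepFun (fun ω i => Z i ω) (fun ω i => g i ω) P
  lintegral_mark : ∀ i, ∫⁻ ω, ENNReal.ofReal (g i ω) ∂P = 1
  lintegral_exp : ∀ i (s : ℝ), -1 < s →
    ∫⁻ ω, ENNReal.ofReal (Real.exp (-(s * g i ω))) ∂P = ENNReal.ofReal (1 / (1 + s))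

section Marked

variable {Ω S : Type*} [MeasurableSpace Ω] [MeasurableSpace S] {P : Measure Ω}
  {Z : ℕ → Ω → S} {ν : Measure S} {g : ℕ → Ω → ℝ}

/-- For independent `X`, `Y`, an expectation of a function of `(X, Y)` is an iterated one. -/
theorem IndepFun.lintegral_comp_prodMk [IsProbabilityMeasure P] {α β : Type*} [MeasurableSpace α]
    [MeasurableSpace β] {X : Ω → α} {Y : Ω → β} (h : IndepFun X Y P) (hX : Measurable X)
    (hY : Measurable Y) {F : α × β → ℝ≥0∞} (hF : Measurable F) :
    ∫⁻ ω, F (X ω, Y ω) ∂P = ∫⁻ ω, ∫⁻ ω', F (X ω, Y ω') ∂P ∂P := by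
  have h1 := (indepFun_iff_map_prod_eq_prod_map_map hX.aemeasurable hY.aemeasurable).1 h
  have : IsProbabilityMeasure (P.map Y) := Measure.isProbabilityMeasure_map hY.aemeasurable
  rw [← lintegral_map (f := F) hF (hX.prodMk hY), h1, lintegral_prod _ hF.aemeasurable,
    lintegral_map hF.lintegral_prod_right' hX]
  congr with ω
  exact lintegral_map (hF.comp measurable_prodMk_left) hY

namespace IsExpMarking

variable (hg : IsExpMarking P Z g)
include hg

/-- The exponential moment at `s = -1/2` equals `2`, and `x² ≤ 8 exp(x/2)` for `x ≥ 0`. -/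
theorem lintegral_mark_sq_le (i : ℕ) :
    ∫⁻ ω, ENNReal.ofReal (g i ω) * ENNReal.ofReal (g i ω) ∂P ≤ 16 := by
  calc ∫⁻ ω, ENNReal.ofReal (g i ω) * ENNReal.ofReal (g i ω) ∂P
      ≤ ∫⁻ ω, 8 * ENNReal.ofReal (Real.exp (-((-1 / 2) * g i ω))) ∂P := by
        refine lintegral_mono fun ω => ?_
        rw [show (8 : ℝ≥0∞) = ENNReal.ofReal 8 by simp, ← ENNReal.ofReal_mul (hg.nonneg i ω),
          ← ENNReal.ofReal_mul (by norm_num)]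
        apply ENNReal.ofReal_le_ofReal
        have h0 := hg.nonneg i ω
        have := Real.quadratic_le_exp_of_nonneg (x := g i ω / 2) (by positivity)
        rw [show -((-1 / 2) * g i ω) = g i ω / 2 by ring]
        nlinarith
    _ = 16 := by
        rw [lintegral_const_mul' _ _ (by simp), hg.lintegral_exp i _ (by norm_num)]
        rw [show (8 : ℝ≥0∞) = ENNReal.ofReal 8 by simp, ← ENNReal.ofReal_mul (by norm_num)]
        norm_num

/-- The `1` is kept also on the diagonal, so that in a double sum the bound splits into the full
second moment of the unmarked sum plus a diagonal correction. -/
theorem lintegral_mark_mul_le (i j : ℕ) :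
    ∫⁻ ω, ENNReal.ofReal (g i ω) * ENNReal.ofReal (g j ω) ∂P ≤ 1 + if i = j then 16 else 0 := by
  split_ifs with h
  · subst h
    exact (hg.lintegral_mark_sq_le i).trans (by simp)
  · have h1 := (hg.indep_marks.indepFun h).comp ENNReal.measurable_ofReal ENNReal.measurable_ofReal
    have := lintegral_mul_eq_lintegral_mul_lintegral_of_indepFun
      (ENNReal.measurable_ofReal.comp (hg.measurable i))
      (ENNReal.measurable_ofReal.comp (hg.measurable j)) h1
    simp only [Function.comp_apply] at this
    rw [hg.lintegral_mark, hg.lintegral_mark] at this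
    simpa using this.le

variable (hZ : ∀ i, Measurable (Z i))
include hZ

theorem lintegral_points_mul_marks {F : (ℕ → S) → ℝ≥0∞} {G : (ℕ → ℝ) → ℝ≥0∞} (hF : Measurable F)
    (hG : Measurable G) :
    ∫⁻ ω, F (fun i => Z i ω) * G (fun i => g i ω) ∂P =
      (∫⁻ ω, F (fun i => Z i ω) ∂P) * ∫⁻ ω, G (fun i => g i ω) ∂P :=
  lintegral_mul_eq_lintegral_mul_lintegral_of_indepFun
    (hF.comp (measurable_pi_lambda _ hZ)) (hG.comp (measurable_pi_lambda _ hg.measurable))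
    (hg.indep_points.comp hF hG)

omit hg in
theorem measurable_markedSum (hgm : ∀ i, Measurable (g i)) {f : S → ℝ≥0∞} (hf : Measurable f) :
    Measurable fun ω => ∑' i, f (Z i ω) * ENNReal.ofReal (g i ω) :=
  Measurable.tsum fun i => (hf.comp (hZ i)).mul (hgm i).ennreal_ofReal

theorem lintegral_markedSum [SigmaFinite ν] (hP : IsPoissonPointProcess P Z ν) {f : S → ℝ≥0∞}
    (hf : Measurable f) :
    ∫⁻ ω, ∑' i, f (Z i ω) * ENNReal.ofReal (g i ω) ∂P = ∫⁻ x, f x ∂ν := by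
  have hfm : ∀ i, Measurable fun ω => f (Z i ω) := fun i => hf.comp (hZ i)
  have hgm : ∀ i, Measurable fun ω => ENNReal.ofReal (g i ω) :=
    fun i => (hg.measurable i).ennreal_ofReal
  rw [lintegral_tsum (f := fun i ω => f (Z i ω) * ENNReal.ofReal (g i ω)) (by fun_prop)]
  have h : ∀ i, ∫⁻ ω, f (Z i ω) * ENNReal.ofReal (g i ω) ∂P = ∫⁻ ω, f (Z i ω) ∂P := by
    intro i
    rw [hg.lintegral_points_mul_marks hZ (F := fun z => f (z i))
      (G := fun y => ENNReal.ofReal (y i)) (by fun_prop) (by fun_prop), hg.lintegral_mark, mul_one]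
  simp_rw [h]
  rw [← hP.lintegral_tsum hf]
  exact (lintegral_tsum fun i => (hf.comp (hZ i)).aemeasurable).symm

/-- A variance bound: of the factor `17`, one unit is the diagonal term in Campbell's second formula
and `16` is the diagonal correction for the marks. -/
theorem lintegral_markedSum_sq_le [SigmaFinite ν] (hP : IsPoissonPointProcess P Z ν)
    {f : S → ℝ≥0∞} (hf : Measurable f) :
    ∫⁻ ω, (∑' i, f (Z i ω) * ENNReal.ofReal (g i ω)) ^ 2 ∂P ≤
      (∫⁻ x, f x ∂ν) ^ 2 + 17 * ∫⁻ x, f x * f x ∂ν := by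
  have hfm : ∀ i, Measurable fun ω => f (Z i ω) := fun i => hf.comp (hZ i)
  have hgm : ∀ i, Measurable fun ω => ENNReal.ofReal (g i ω) :=
    fun i => (hg.measurable i).ennreal_ofReal
  have h1 : ∀ ω, (∑' i, f (Z i ω) * ENNReal.ofReal (g i ω)) ^ 2 = ∑' i, ∑' j,
      (f (Z i ω) * f (Z j ω)) * (ENNReal.ofReal (g i ω) * ENNReal.ofReal (g j ω)) := by
    intro ω
    rw [sq, ← ENNReal.tsum_mul_right]
    congr with i
    rw [← ENNReal.tsum_mul_left]
    congr with j
    ring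
  have h2 : ∀ i j, ∫⁻ ω, (f (Z i ω) * f (Z j ω)) *
      (ENNReal.ofReal (g i ω) * ENNReal.ofReal (g j ω)) ∂P ≤
      (∫⁻ ω, f (Z i ω) * f (Z j ω) ∂P) + if i = j then 16 * ∫⁻ ω, f (Z i ω) * f (Z i ω) ∂P
        else 0 := by
    intro i j
    rw [hg.lintegral_points_mul_marks hZ (F := fun z => f (z i) * f (z j))
      (G := fun y => ENNReal.ofReal (y i) * ENNReal.ofReal (y j)) (by fun_prop) (by fun_prop)]
    refine (mul_le_mul_right (hg.lintegral_mark_mul_le i j) _).trans (le_of_eq ?_)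
    rw [mul_add, mul_one]
    split_ifs with h
    · subst h; ring
    · simp
  have h3 : (∑' i, ∑' j, ∫⁻ ω, f (Z i ω) * f (Z j ω) ∂P) =
      (∫⁻ x, f x ∂ν) ^ 2 + ∫⁻ x, f x * f x ∂ν := by
    rw [sq, ← hP.lintegral_tsum_mul_tsum hf hf]
    simp_rw [← ENNReal.tsum_mul_right, ← ENNReal.tsum_mul_left]
    rw [lintegral_tsum (f := fun i ω => ∑' j, f (Z i ω) * f (Z j ω)) (by fun_prop)]
    congr with i
    rw [lintegral_tsum (f := fun j ω => f (Z i ω) * f (Z j ω)) (by fun_prop)]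
  have h4 : (∑' i, ∫⁻ ω, f (Z i ω) * f (Z i ω) ∂P) = ∫⁻ x, f x * f x ∂ν := by
    rw [← hP.lintegral_tsum (f := fun x => f x * f x) (hf.mul hf)]
    exact (lintegral_tsum fun i => ((hfm i).mul (hfm i)).aemeasurable).symm
  simp_rw [h1]
  rw [lintegral_tsum (f := fun i ω => ∑' j, (f (Z i ω) * f (Z j ω)) *
    (ENNReal.ofReal (g i ω) * ENNReal.ofReal (g j ω))) (by fun_prop)]
  simp_rw [fun i => lintegral_tsum (μ := P) (f := fun j ω => (f (Z i ω) * f (Z j ω)) *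
    (ENNReal.ofReal (g i ω) * ENNReal.ofReal (g j ω))) (by fun_prop)]
  calc _ ≤ ∑' i, ∑' j, ((∫⁻ ω, f (Z i ω) * f (Z j ω) ∂P) +
        if i = j then 16 * ∫⁻ ω, f (Z i ω) * f (Z i ω) ∂P else 0) :=
        ENNReal.tsum_le_tsum fun i => ENNReal.tsum_le_tsum fun j => h2 i j
    _ = (∫⁻ x, f x ∂ν) ^ 2 + ∫⁻ x, f x * f x ∂ν + 16 * ∫⁻ x, f x * f x ∂ν := by
        simp_rw [ENNReal.tsum_add, tsum_ite_eq', ENNReal.tsum_mul_left]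
        rw [h3, h4]
    _ = _ := by ring

end IsExpMarking

end Marked

/-- Random variables with a common mean and summable variances converge almost surely. -/
theorem ae_tendsto_of_summable_variance {Ω : Type*} [MeasurableSpace Ω] {P : Measure Ω}
    [IsProbabilityMeasure P] {X : ℕ → Ω → ℝ≥0∞} (hX : ∀ k, Measurable (X k)) {m : ℝ≥0∞}
    (hm : m ≠ ∞) {v : ℕ → ℝ≥0∞} (hv : ∑' k, v k ≠ ∞) (hX1 : ∀ k, ∫⁻ ω, X k ω ∂P = m)
    (hX2 : ∀ k, ∫⁻ ω, X k ω ^ 2 ∂P ≤ m ^ 2 + v k) :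
    ∀ᵐ ω ∂P, Tendsto (fun k => X k ω) atTop (𝓝 m) := by
  have hfin : ∀ᵐ ω ∂P, ∀ k, X k ω < ∞ := by
    rw [ae_all_iff]
    exact fun k => ae_lt_top (hX k) (by rw [hX1]; exact hm)
  have hY : ∀ k, Measurable fun ω => ENNReal.ofReal (((X k ω).toReal - m.toReal) ^ 2) := by
    intro k
    have := hX k
    fun_prop
  have hE : ∀ k, ∫⁻ ω, ENNReal.ofReal (((X k ω).toReal - m.toReal) ^ 2) ∂P ≤ v k := by
    intro k
    have h1 : ∀ᵐ ω ∂P, ENNReal.ofReal (((X k ω).toReal - m.toReal) ^ 2) + 2 * m * X k ω =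
        X k ω ^ 2 + m ^ 2 := by
      -- The expansion of the square is stated additively to avoid truncated subtraction; lifting
      -- both finite values to reals then reduces it to `ring`.
      filter_upwards [hfin] with ω hω
      obtain ⟨x, hx⟩ : ∃ x : ℝ≥0, X k ω = x := ⟨_, (ENNReal.coe_toNNReal (hω k).ne).symm⟩
      obtain ⟨y, hy⟩ : ∃ y : ℝ≥0, m = y := ⟨_, (ENNReal.coe_toNNReal hm).symm⟩
      rw [hx, hy, ENNReal.coe_toReal, ENNReal.coe_toReal, ← ENNReal.ofReal_coe_nnreal,
        ← ENNReal.ofReal_coe_nnreal, ← ENNReal.ofReal_pow x.coe_nonneg, ← ENNReal.ofReal_pow y.coe_nonneg,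
        ← ENNReal.ofReal_add (by positivity) (by positivity),
        show (2 : ℝ≥0∞) = ENNReal.ofReal 2 by simp, ← ENNReal.ofReal_mul (by positivity),
        ← ENNReal.ofReal_mul (by positivity), ← ENNReal.ofReal_add (by positivity) (by positivity)]
      congr 1
      ring
    have h2 := lintegral_congr_ae h1
    rw [lintegral_add_right _ ((hX k).const_mul _), lintegral_add_right _ measurable_const,
      lintegral_const_mul _ (hX k), hX1] at h2
    simp only [lintegral_const, measure_univ, mul_one] at h2
    have h3 : 2 * m * m ≠ ∞ := by finiteness
    rw [← ENNReal.add_le_add_iff_right h3, h2]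
    calc _ ≤ m ^ 2 + v k + m ^ 2 := by gcongr; exact hX2 k
      _ = _ := by ring
  -- The squared deviations have a finite expected sum, so almost surely they are summable and tend
  -- to zero. No joint law of the variables enters.
  have hsum : ∫⁻ ω, ∑' k, ENNReal.ofReal (((X k ω).toReal - m.toReal) ^ 2) ∂P ≠ ∞ := by
    rw [lintegral_tsum fun k => (hY k).aemeasurable]
    exact ne_top_of_le_ne_top hv (ENNReal.tsum_le_tsum hE)
  filter_upwards [hfin, ae_lt_top (Measurable.tsum hY) hsum] with ω hω hs
  have h1 := ENNReal.tendsto_atTop_zero_of_tsum_ne_top hs.ne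
  have h2 : Tendsto (fun k => ((X k ω).toReal - m.toReal) ^ 2) atTop (𝓝 0) := by
    have := (ENNReal.tendsto_toReal ENNReal.zero_ne_top).comp h1
    simpa [Function.comp_def, ENNReal.toReal_ofReal, sq_nonneg] using this
  have h3 : Tendsto (fun k => |(X k ω).toReal - m.toReal|) atTop (𝓝 0) := by
    have := (Real.continuous_sqrt.tendsto 0).comp h2
    simpa [Function.comp_def, Real.sqrt_sq_eq_abs] using this
  have h4 : Tendsto (fun k => (X k ω).toReal) atTop (𝓝 m.toReal) := by
    rw [tendsto_iff_norm_sub_tendsto_zero]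
    exact h3
  exact (ENNReal.tendsto_toReal_iff (fun k => (hω k).ne) hm).1 h4

/-! ### The complex Gaussian law -/

theorem measurable_complex_mk : Measurable fun p : ℝ × ℝ => (⟨p.1, p.2⟩ : ℂ) :=
  Complex.measurableEquivRealProd.symm.measurable

instance : IsProbabilityMeasure complexGaussian :=
  Measure.isProbabilityMeasure_map measurable_complex_mk.aemeasurable

theorem charFun_complexGaussian (t : ℂ) :
    charFun complexGaussian t = Complex.exp (-(‖t‖ ^ 2 / 4 : ℝ)) := by
  have h : ∀ p : ℝ × ℝ, Complex.exp ((inner ℝ (⟨p.1, p.2⟩ : ℂ) t : ℝ) * Complex.I) =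
      Complex.exp ((inner ℝ p.1 t.re : ℝ) * Complex.I) *
        Complex.exp ((inner ℝ p.2 t.im : ℝ) * Complex.I) := by
    intro p
    rw [← Complex.exp_add, Complex.inner]
    congr 1
    simp
    ring
  rw [charFun_apply, complexGaussian, integral_map measurable_complex_mk.aemeasurable
    (by fun_prop)]
  simp_rw [h]
  rw [integral_prod_mul (fun x : ℝ => Complex.exp ((inner ℝ x t.re : ℝ) * Complex.I))
    (fun x : ℝ => Complex.exp ((inner ℝ x t.im : ℝ) * Complex.I)), ← charFun_apply,
    ← charFun_apply, charFun_gaussianReal, charFun_gaussianReal, ← Complex.exp_add,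
    Complex.sq_norm, Complex.normSq_apply]
  congr 1
  push_cast
  ring

theorem complexGaussian_singleton_zero : complexGaussian {0} = 0 := by
  have : NullSingletonClass (gaussianReal 0 (1 / 2)) := nullSingletonClass_gaussianReal (by simp)
  rw [complexGaussian, Measure.map_apply measurable_complex_mk (measurableSet_singleton _)]
  refine measure_mono_null (t := {0} ×ˢ univ) ?_ ?_
  · intro p hp
    have := congrArg Complex.re (show (⟨p.1, p.2⟩ : ℂ) = 0 from hp)
    simpa using this
  · rw [Measure.prod_prod, measure_singleton, zero_mul]

theorem lintegral_complexGaussian_mul {f : ℝ → ℝ≥0∞} (hf : Measurable f) :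
    ∫⁻ z : ℂ, f z.re * f z.im ∂complexGaussian =
      (∫⁻ x, f x ∂(gaussianReal 0 (1 / 2))) * ∫⁻ x, f x ∂(gaussianReal 0 (1 / 2)) := by
  rw [complexGaussian, lintegral_map (by fun_prop) measurable_complex_mk]
  exact lintegral_prod_mul hf.aemeasurable hf.aemeasurable

theorem lintegral_exp_neg_sq_gaussianReal {s : ℝ} (hs : -1 < s) :
    ∫⁻ x, ENNReal.ofReal (Real.exp (-(s * x ^ 2))) ∂(gaussianReal 0 (1 / 2)) =
      ENNReal.ofReal (Real.sqrt (1 / (1 + s))) := by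
  rw [gaussianReal_of_var_ne_zero _ (by simp),
    lintegral_withDensity_eq_lintegral_mul _ (measurable_gaussianPDF _ _) (by fun_prop)]
  have h : ∀ x : ℝ, (gaussianPDF 0 (1 / 2) * fun x => ENNReal.ofReal (Real.exp (-(s * x ^ 2)))) x =
      ENNReal.ofReal ((Real.sqrt Real.pi)⁻¹ * Real.exp (-(1 + s) * x ^ 2)) := by
    intro x
    rw [Pi.mul_apply, gaussianPDF_def, ← ENNReal.ofReal_mul (gaussianPDFReal_nonneg _ _ _),
      gaussianPDFReal_def]
    congr 1
    rw [mul_assoc, ← Real.exp_add]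
    congr 2
    · rw [show 2 * Real.pi * ((1 / 2 : ℝ≥0) : ℝ) = Real.pi by push_cast; ring]
    · norm_num
      ring
  simp_rw [h]
  rw [← ofReal_integral_eq_lintegral_ofReal
    ((integrable_exp_neg_mul_sq (by linarith)).const_mul _) (ae_of_all _ fun x => by positivity),
    integral_const_mul, integral_gaussian]
  congr 1
  rw [Real.sqrt_div Real.pi_pos.le, Real.sqrt_div zero_le_one, Real.sqrt_one]
  have := Real.sqrt_pos.2 Real.pi_pos
  field_simp

/-- The squared modulus has the unit exponential Laplace transform, because the two coordinates each
contribute `(1 + s)^(-1/2)`. -/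
theorem lintegral_exp_neg_sq_complexGaussian {s : ℝ} (hs : -1 < s) :
    ∫⁻ z : ℂ, ENNReal.ofReal (Real.exp (-(s * ‖z‖ ^ 2))) ∂complexGaussian =
      ENNReal.ofReal (1 / (1 + s)) := by
  have h : ∀ z : ℂ, ENNReal.ofReal (Real.exp (-(s * ‖z‖ ^ 2))) =
      ENNReal.ofReal (Real.exp (-(s * z.re ^ 2))) * ENNReal.ofReal (Real.exp (-(s * z.im ^ 2))) := by
    intro z
    rw [← ENNReal.ofReal_mul (by positivity), ← Real.exp_add, Complex.sq_norm,
      Complex.normSq_apply]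
    ring_nf
  simp_rw [h]
  have h1 : 0 < 1 + s := by linarith
  rw [lintegral_complexGaussian_mul (f := fun x => ENNReal.ofReal (Real.exp (-(s * x ^ 2))))
    (by fun_prop), lintegral_exp_neg_sq_gaussianReal hs, ← ENNReal.ofReal_mul (by positivity),
    Real.mul_self_sqrt (by positivity)]

theorem lintegral_sq_gaussianReal :
    ∫⁻ x, ENNReal.ofReal (x ^ 2) ∂(gaussianReal 0 (1 / 2)) = ENNReal.ofReal (1 / 2) := by
  have hm := memLp_id_gaussianReal (μ := 0) (v := 1 / 2) 2
  rw [← ofReal_integral_eq_lintegral_ofReal (f := fun x : ℝ => x ^ 2)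
    hm.integrable_sq (ae_of_all _ fun x => by positivity)]
  have h1 := variance_eq_sub hm
  rw [variance_id_gaussianReal] at h1
  simp only [id_eq, integral_id_gaussianReal] at h1
  congr 1
  simp at h1
  simp [h1]

theorem lintegral_sq_norm_complexGaussian :
    ∫⁻ z : ℂ, ENNReal.ofReal (‖z‖ ^ 2) ∂complexGaussian = 1 := by
  have h : ∀ z : ℂ, ENNReal.ofReal (‖z‖ ^ 2) =
      ENNReal.ofReal (z.re ^ 2) + ENNReal.ofReal (z.im ^ 2) := by
    intro z
    rw [← ENNReal.ofReal_add (by positivity) (by positivity), Complex.sq_norm,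
      Complex.normSq_apply]
    ring_nf
  simp_rw [h]
  rw [lintegral_add_left (by fun_prop), complexGaussian,
    lintegral_map (by fun_prop) measurable_complex_mk,
    lintegral_map (by fun_prop) measurable_complex_mk]
  have h1 := lintegral_prod_mul (μ := gaussianReal 0 (1 / 2)) (ν := gaussianReal 0 (1 / 2))
    (f := fun x => ENNReal.ofReal (x ^ 2)) (g := fun _ => 1) (by fun_prop) (by fun_prop)
  have h2 := lintegral_prod_mul (μ := gaussianReal 0 (1 / 2)) (ν := gaussianReal 0 (1 / 2))
    (f := fun _ => 1) (g := fun x => ENNReal.ofReal (x ^ 2)) (by fun_prop) (by fun_prop)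
  simp only [mul_one, one_mul, lintegral_one, measure_univ, lintegral_sq_gaussianReal] at h1 h2
  rw [h1, h2, ← ENNReal.ofReal_add (by norm_num) (by norm_num)]
  norm_num

/-- Invariance of the i.i.d. complex Gaussian vectors under unitary maps. -/
theorem map_sum_mul_complexGaussian {Ω : Type*} [MeasurableSpace Ω] {P : Measure Ω}
    {n : ℕ} {H : Fin n → Ω → ℂ} (hH : ∀ a, HasLaw (H a) complexGaussian P)
    (hi : iIndepFun H P) {v : Fin n → ℂ} (hv : ∑ a, ‖v a‖ ^ 2 = 1) :
    P.map (fun ω => ∑ a, H a ω * v a) = complexGaussian := by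
  have := hi.isProbabilityMeasure
  have hm : ∀ a, AEMeasurable (fun ω => H a ω * v a) P := fun a =>
    (hH a).aemeasurable.mul_const _
  have : IsProbabilityMeasure (P.map (fun ω => ∑ a, H a ω * v a)) :=
    Measure.isProbabilityMeasure_map (Finset.univ.aemeasurable_fun_sum fun a _ => hm a)
  refine Measure.ext_of_charFun ?_
  have hi' : iIndepFun (fun a ω => H a ω * v a) P :=
    hi.comp (fun a z => z * v a) (fun a => by fun_prop)
  rw [hi'.charFun_map_fun_sum_eq_prod hm]
  ext t
  -- Multiplication by `v a` is moved to the other side of the real inner product as multiplication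
  -- by its conjugate.
  have h1 : ∀ a, charFun (P.map (fun ω => H a ω * v a)) t =
      Complex.exp (-(‖v a‖ ^ 2 * ‖t‖ ^ 2 / 4 : ℝ)) := by
    intro a
    rw [charFun_apply, integral_map (hm a) (by fun_prop)]
    have h2 := charFun_complexGaussian (starRingEnd ℂ (v a) * t)
    rw [charFun_apply, ← (hH a).map_eq, integral_map (hH a).aemeasurable (by fun_prop)] at h2
    rw [norm_mul, RCLike.norm_conj, mul_pow] at h2
    rw [← h2]
    congr with ω
    congr 3
    simp only [Complex.inner, map_mul]
    ring_nf
  rw [Finset.prod_apply]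
  simp_rw [h1]
  rw [← Complex.exp_sum, charFun_complexGaussian]
  congr 1
  rw [Finset.sum_neg_distrib, ← Complex.ofReal_sum, ← Finset.sum_div, ← Finset.sum_mul, hv, one_mul]

/-! ### Gains under maximum ratio transmission -/

theorem measurable_beamGain_mrtPrecoder (n : ℕ) :
    Measurable fun p : (Fin n → ℂ) × (Fin n → ℂ) => beamGain p.2 (mrtPrecoder p.1) := by
  unfold beamGain mrtPrecoder
  fun_prop

theorem sum_sq_norm_mrtPrecoder {n : ℕ} {w : Fin n → ℂ} {a : Fin n} (hw : w a ≠ 0) :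
    ∑ b, ‖mrtPrecoder w b‖ ^ 2 = 1 := by
  have hpos : 0 < ∑ b, ‖w b‖ ^ 2 :=
    Finset.sum_pos' (fun b _ => by positivity) ⟨a, Finset.mem_univ _, by positivity⟩
  simp only [mrtPrecoder, norm_div, RCLike.norm_conj, div_pow, Complex.norm_real, Real.norm_eq_abs,
    sq_abs, Real.sq_sqrt hpos.le]
  rw [← Finset.sum_div, div_self hpos.ne']

theorem beamGain_mrtPrecoder_self {n : ℕ} (h : Fin n → ℂ) :
    beamGain h (mrtPrecoder h) = ∑ a, ‖h a‖ ^ 2 := by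
  have hnn : 0 ≤ ∑ b, ‖h b‖ ^ 2 := Finset.sum_nonneg fun b _ => by positivity
  have h1 : ∑ a, h a * mrtPrecoder h a = ((Real.sqrt (∑ b, ‖h b‖ ^ 2) : ℝ) : ℂ) := by
    simp only [mrtPrecoder, ← mul_div_assoc, Complex.mul_conj, Complex.normSq_eq_norm_sq]
    rw [← Finset.sum_div, ← Complex.ofReal_sum, ← Complex.ofReal_div, Real.div_sqrt]
  rw [beamGain, h1, Complex.norm_real, Real.norm_eq_abs, sq_abs, Real.sq_sqrt hnn]

/-- Conditionally on `W`, the precoder is almost surely a fixed unit vector, and the projection of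
`H` on it is again standard complex Gaussian. Hence the law of the gain does not depend on `n`. -/
theorem lintegral_beamGain_mrtPrecoder {Ω : Type*} [MeasurableSpace Ω] {P : Measure Ω}
    {n : ℕ} (hn : 1 ≤ n) {H W : Fin n → Ω → ℂ} (hHm : ∀ a, Measurable (H a))
    (hWm : ∀ a, Measurable (W a)) (hH : ∀ a, HasLaw (H a) complexGaussian P)
    (hW : ∀ a, HasLaw (W a) complexGaussian P) (hi : iIndepFun H P)
    (hHW : IndepFun (fun ω a => W a ω) (fun ω a => H a ω) P) {F : ℝ → ℝ≥0∞} (hF : Measurable F) :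
    ∫⁻ ω, F (beamGain (fun a => H a ω) (mrtPrecoder fun a => W a ω)) ∂P =
      ∫⁻ z : ℂ, F (‖z‖ ^ 2) ∂complexGaussian := by
  have := hi.isProbabilityMeasure
  rw [IndepFun.lintegral_comp_prodMk hHW (measurable_pi_lambda _ hWm) (measurable_pi_lambda _ hHm)
    (F := fun p => F (beamGain p.2 (mrtPrecoder p.1)))
    (hF.comp (measurable_beamGain_mrtPrecoder n))]
  -- For a zero channel the precoder is the zero vector by division by zero; one nonzero entry rules
  -- this out.
  have hne : ∀ᵐ ω ∂P, W ⟨0, hn⟩ ω ≠ 0 := by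
    have := (hW ⟨0, hn⟩).measure_eq (p := fun z => z = 0) (measurableSet_singleton _)
    rw [show {z : ℂ | z = 0} = {0} from rfl, complexGaussian_singleton_zero] at this
    simpa [ae_iff] using this
  have key : ∀ᵐ ω ∂P, ∫⁻ ω', F (beamGain (fun a => H a ω') (mrtPrecoder fun a => W a ω)) ∂P =
      ∫⁻ z : ℂ, F (‖z‖ ^ 2) ∂complexGaussian := by
    filter_upwards [hne] with ω hω
    rw [← map_sum_mul_complexGaussian hH hi (sum_sq_norm_mrtPrecoder (w := fun a => W a ω) hω),
      lintegral_map (by fun_prop) (by fun_prop)]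
    rfl
  rw [lintegral_congr_ae key, lintegral_const, measure_univ, mul_one]

/-! ### Independence of functions of disjoint blocks -/

section Blocks

variable {Ω : Type*} {mΩ : MeasurableSpace Ω} {P : Measure Ω} {ι κ : Type*} {β : ι → Type*}
  {γ : κ → Type*} {mβ : ∀ i, MeasurableSpace (β i)} {mγ : ∀ k, MeasurableSpace (γ k)}
  {f : ∀ i, Ω → β i} {g : ∀ k, Ω → γ k}

/-- Induction on the finite index set: the new block is disjoint from the union of the earlier
blocks, so independence of two sigma-algebras suffices at each step. -/
theorem iIndepFun.of_measurable_iSup_comap (hf : iIndepFun f P) (hfm : ∀ i, Measurable (f i))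
    {S : κ → Set ι} (hS : Pairwise fun j k => Disjoint (S j) (S k))
    (hg : ∀ k, Measurable[⨆ i ∈ S k, (mβ i).comap (f i)] (g k)) : iIndepFun g P := by
  classical
  have := hf.isProbabilityMeasure
  rw [iIndepFun_iff_measure_inter_preimage_eq_mul]
  intro s A hA
  induction s using Finset.induction with
  | empty => simp
  | insert a s ha ih =>
    rw [Finset.set_biInter_insert, Finset.prod_insert ha,
      ← ih fun i hi => hA i (Finset.mem_insert_of_mem hi)]
    have hd : Disjoint (S a) (⋃ k ∈ s, S k) := by
      simp only [disjoint_iUnion_right]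
      exact fun k hk => hS (fun h => ha (h ▸ hk))
    have hi := indep_iSup_of_disjoint (fun i => (hfm i).comap_le) hf.iIndep hd
    rw [Indep_iff] at hi
    refine hi _ _ (hg a (hA a (Finset.mem_insert_self a s))) ?_
    refine Finset.measurableSet_biInter _ fun k hk => ?_
    have hle : (⨆ i ∈ S k, (mβ i).comap (f i)) ≤ ⨆ i ∈ ⋃ k ∈ s, S k, (mβ i).comap (f i) :=
      biSup_mono fun i hi => mem_biUnion hk hi
    exact hle _ (hg k (hA k (Finset.mem_insert_of_mem hk)))

theorem iIndepFun.indepFun_of_measurable_iSup_comap (hf : iIndepFun f P)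
    (hfm : ∀ i, Measurable (f i)) {S T : Set ι} (hST : Disjoint S T) {α δ : Type*}
    {mα : MeasurableSpace α} {mδ : MeasurableSpace δ} {u : Ω → α} {v : Ω → δ}
    (hu : Measurable[⨆ i ∈ S, (mβ i).comap (f i)] u)
    (hv : Measurable[⨆ i ∈ T, (mβ i).comap (f i)] v) : IndepFun u v P := by
  have hi := indep_iSup_of_disjoint (fun i => (hfm i).comap_le) hf.iIndep hST
  rw [IndepFun_iff_Indep]
  exact indep_of_indep_of_le_left (indep_of_indep_of_le_right hi hv.comap_le) hu.comap_le

theorem measurable_iSup_comap {S : Set ι} {i : ι} (hi : i ∈ S) :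
    Measurable[⨆ i ∈ S, (mβ i).comap (f i)] (f i) :=
  (comap_measurable (f i)).mono (le_iSup₂ (f := fun i (_ : i ∈ S) => (mβ i).comap (f i)) i hi)
    le_rfl

theorem measurable_pi_of_forall {δ : Type*} {mδ : MeasurableSpace δ} {u : ∀ k, δ → γ k}
    (hu : ∀ k, Measurable (u k)) : Measurable fun x k => u k x :=
  measurable_pi_lambda _ hu

theorem measurable_beamGain_mrtPrecoder_comp {n : ℕ} {δ : Type*} {mδ : MeasurableSpace δ}
    {H W : Fin n → δ → ℂ} (hH : ∀ a, Measurable (H a)) (hW : ∀ a, Measurable (W a)) :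
    Measurable fun x => beamGain (fun a => H a x) (mrtPrecoder fun a => W a x) := by
  unfold beamGain mrtPrecoder
  fun_prop

end Blocks

/-! ### The fading coefficients of a network -/

namespace MISONetwork

variable {Ω : Type*} [MeasurableSpace Ω] {P : Measure Ω} (X : MISONetwork P)

/-- All fading coefficients of the network with `n` antennas per BS. -/
abbrev fading (n : ℕ) : ℕ ⊕ (ℕ × Fin n ⊕ ℕ × Fin n) → Ω → ℂ :=
  Sum.elim X.serv (Sum.elim (fun p : ℕ × Fin n => X.cross n p.1 p.2)
    (fun p : ℕ × Fin n => X.own n p.1 p.2))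

/-- The point process of locations and levels. -/
abbrev point (i : ℕ) (ω : Ω) : Plane × ℝ := (X.pos i ω, X.level i ω)

/-- The fading coefficients are measurable, and not only almost everywhere measurable. -/
structure MeasurableFading : Prop where
  serv : ∀ a, Measurable (X.serv a)
  cross : ∀ n i a, Measurable (X.cross n i a)
  own : ∀ n i a, Measurable (X.own n i a)

/-- `HasLaw` only gives almost everywhere measurability. There are countably many coefficients, so
all of them can be replaced by measurable versions off a single null set. -/
theorem exists_measurableFading : ∃ Y : MISONetwork P, Y.MeasurableFading ∧ Y.pos = X.pos ∧
    Y.level = X.level ∧ ∀ᵐ ω ∂P, (∀ a, Y.serv a ω = X.serv a ω) ∧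
      (∀ n i a, Y.cross n i a ω = X.cross n i a ω) ∧ ∀ n i a, Y.own n i a ω = X.own n i a ω := by
  have hs : ∀ a, AEMeasurable (X.serv a) P := fun a => (X.serv_law a).aemeasurable
  have hc : ∀ n i a, AEMeasurable (X.cross n i a) P := fun n i a => (X.cross_law n i a).aemeasurable
  have ho : ∀ n i a, AEMeasurable (X.own n i a) P := fun n i a => (X.own_law n i a).aemeasurable
  have hF : ∀ n c, X.fading n c =ᵐ[P] Sum.elim (fun a => (hs a).mk) (Sum.elim
      (fun p : ℕ × Fin n => (hc n p.1 p.2).mk) (fun p : ℕ × Fin n => (ho n p.1 p.2).mk)) c := by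
    rintro n (a | ⟨i, a⟩ | ⟨i, a⟩)
    · exact (hs a).ae_eq_mk
    · exact (hc n i a).ae_eq_mk
    · exact (ho n i a).ae_eq_mk
  refine ⟨⟨X.pos, X.level, fun a => (hs a).mk, fun n i a => (hc n i a).mk,
    fun n i a => (ho n i a).mk, X.poisson, fun a => (X.serv_law a).congr (hs a).ae_eq_mk.symm,
    fun n i a => (X.cross_law n i a).congr (hc n i a).ae_eq_mk.symm,
    fun n i a => (X.own_law n i a).congr (ho n i a).ae_eq_mk.symm,
    fun n => ?_, fun n => ?_⟩, ⟨fun a => (hs a).measurable_mk, fun n i a => (hc n i a).measurable_mk,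
    fun n i a => (ho n i a).measurable_mk⟩, rfl, rfl, ?_⟩
  · exact (iIndepFun_congr (hF n)).1 (X.indep_fading n)
  · refine (X.indep_locations n).congr (ae_eq_refl _) ?_
    filter_upwards [ae_all_iff.2 (hF n)] with ω hω
    funext c
    exact hω c
  · have h1 : ∀ᵐ ω ∂P, ∀ a, X.serv a ω = (hs a).mk _ ω := ae_all_iff.2 fun a => (hs a).ae_eq_mk
    have h2 : ∀ᵐ ω ∂P, ∀ n i a, X.cross n i a ω = (hc n i a).mk _ ω := by
      simp_rw [ae_all_iff]
      exact fun n i a => (hc n i a).ae_eq_mk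
    have h3 : ∀ᵐ ω ∂P, ∀ n i a, X.own n i a ω = (ho n i a).mk _ ω := by
      simp_rw [ae_all_iff]
      exact fun n i a => (ho n i a).ae_eq_mk
    filter_upwards [h1, h2, h3] with ω h1 h2 h3
    exact ⟨fun a => (h1 a).symm, fun n i a => (h2 n i a).symm, fun n i a => (h3 n i a).symm⟩

theorem measurable_point (i : ℕ) : Measurable (X.point i) := X.poisson.measurable i

theorem crossGain_nonneg (n i : ℕ) (ω : Ω) : 0 ≤ X.crossGain n i ω := by
  unfold crossGain beamGain
  positivity

theorem servGain_eq (n : ℕ) (ω : Ω) : X.servGain n ω = ∑ a ∈ Finset.range n, ‖X.serv a ω‖ ^ 2 := by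
  rw [servGain, beamGain_mrtPrecoder_self, Finset.sum_range]

theorem servGain_nonneg (n : ℕ) (ω : Ω) : 0 ≤ X.servGain n ω := by
  rw [servGain_eq]
  positivity

variable {X}

namespace MeasurableFading

variable (hX : X.MeasurableFading)
include hX

theorem fading (n : ℕ) (c : ℕ ⊕ (ℕ × Fin n ⊕ ℕ × Fin n)) : Measurable (X.fading n c) := by
  rcases c with a | ⟨i, a⟩ | ⟨i, a⟩
  · exact hX.serv a
  · exact hX.cross n i a
  · exact hX.own n i a

theorem crossGain (n i : ℕ) : Measurable (X.crossGain n i) :=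
  measurable_beamGain_mrtPrecoder_comp (hX.cross n i) (hX.own n i)

theorem servGain (n : ℕ) : Measurable (X.servGain n) := by
  have := hX.serv
  simp_rw [funext (X.servGain_eq n)]
  fun_prop

omit hX in
theorem measurable_crossGain_iSup (n i : ℕ) :
    Measurable[⨆ c ∈ {c : ℕ ⊕ (ℕ × Fin n ⊕ ℕ × Fin n) | ∃ a, c = .inr (.inl (i, a)) ∨
      c = .inr (.inr (i, a))}, MeasurableSpace.comap (X.fading n c) inferInstance]
      (X.crossGain n i) := by
  refine measurable_beamGain_mrtPrecoder_comp (H := X.cross n i) (W := X.own n i)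
    (fun a => ?_) (fun a => ?_)
  · exact measurable_iSup_comap (f := X.fading n) (i := .inr (.inl (i, a))) ⟨a, Or.inl rfl⟩
  · exact measurable_iSup_comap (f := X.fading n) (i := .inr (.inr (i, a))) ⟨a, Or.inr rfl⟩

theorem lintegral_comp_crossGain {n : ℕ} (hn : 1 ≤ n) (i : ℕ) {F : ℝ → ℝ≥0∞} (hF : Measurable F) :
    ∫⁻ ω, F (X.crossGain n i ω) ∂P = ∫⁻ z : ℂ, F (‖z‖ ^ 2) ∂complexGaussian := by
  refine lintegral_beamGain_mrtPrecoder hn (hX.cross n i) (hX.own n i) (X.cross_law n i)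
    (X.own_law n i) ?_ ?_ hF
  · exact (X.indep_fading n).precomp (g := fun a : Fin n => .inr (.inl (i, a)))
      (fun a b h => by simpa using h)
  · refine iIndepFun.indepFun_of_measurable_iSup_comap (X.indep_fading n) (hX.fading n)
      (S := {c | ∃ a, c = .inr (.inr (i, a))}) (T := {c | ∃ a, c = .inr (.inl (i, a))}) ?_ ?_ ?_
    · rw [Set.disjoint_left]
      rintro c ⟨a, rfl⟩ ⟨b, hb⟩
      simp at hb
    · refine measurable_pi_of_forall (u := fun a ω => X.own n i a ω) fun a => ?_
      exact measurable_iSup_comap (f := X.fading n) (i := .inr (.inr (i, a))) ⟨a, rfl⟩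
    · refine measurable_pi_of_forall (u := fun a ω => X.cross n i a ω) fun a => ?_
      exact measurable_iSup_comap (f := X.fading n) (i := .inr (.inl (i, a))) ⟨a, rfl⟩

omit hX in
theorem indepFun_point_crossGain (n : ℕ) :
    IndepFun (fun ω i => X.point i ω) (fun ω i => X.crossGain n i ω) P := by
  have hψ : Measurable fun (c : ℕ ⊕ (ℕ × Fin n ⊕ ℕ × Fin n) → ℂ) (i : ℕ) => beamGain
      (fun a => c (.inr (.inl (i, a)))) (mrtPrecoder fun a => c (.inr (.inr (i, a)))) := by
    refine measurable_pi_lambda _ fun i => ?_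
    exact measurable_beamGain_mrtPrecoder_comp
      (H := fun a (c : ℕ ⊕ (ℕ × Fin n ⊕ ℕ × Fin n) → ℂ) => c (.inr (.inl (i, a))))
      (W := fun a c => c (.inr (.inr (i, a)))) (fun a => measurable_pi_apply _)
      (fun a => measurable_pi_apply _)
  exact (X.indep_locations n).comp (φ := id) measurable_id hψ

theorem isExpMarking {n : ℕ} (hn : 1 ≤ n) : IsExpMarking P X.point (X.crossGain n) where
  measurable := hX.crossGain n
  nonneg := X.crossGain_nonneg n
  indep_marks := by
    refine iIndepFun.of_measurable_iSup_comap (X.indep_fading n) (hX.fading n) ?_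
      (fun i => measurable_crossGain_iSup n i)
    intro i j hij
    rw [Set.disjoint_left]
    rintro c ⟨a, rfl | rfl⟩ ⟨b, hb | hb⟩ <;> simp_all
  indep_points := indepFun_point_crossGain n
  lintegral_mark i := by
    rw [hX.lintegral_comp_crossGain hn i ENNReal.measurable_ofReal,
      lintegral_sq_norm_complexGaussian]
  lintegral_exp i s hs := by
    rw [hX.lintegral_comp_crossGain hn i (F := fun x => ENNReal.ofReal (Real.exp (-(s * x))))
      (by fun_prop), lintegral_exp_neg_sq_complexGaussian hs]

theorem lintegral_sq_norm_serv (a : ℕ) : ∫⁻ ω, ENNReal.ofReal (‖X.serv a ω‖ ^ 2) ∂P = 1 := by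
  rw [← lintegral_sq_norm_complexGaussian, ← (X.serv_law a).map_eq,
    lintegral_map (by fun_prop) (hX.serv a)]

theorem lintegral_servGain (n : ℕ) : ∫⁻ ω, ENNReal.ofReal (X.servGain n ω) ∂P = n := by
  have := hX.serv
  simp_rw [X.servGain_eq, ENNReal.ofReal_sum_of_nonneg fun _ _ => sq_nonneg _]
  rw [lintegral_finsetSum _ fun a _ => by fun_prop]
  simp_rw [hX.lintegral_sq_norm_serv]
  simp

/-- Locations are independent of all fading, and the serving channel is independent of the
interfering channels; with the locations frozen, the expectation factors and the serving gain
contributes its mean `n`. -/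
theorem lintegral_servGain_mul [IsProbabilityMeasure P] (n : ℕ)
    {F : (ℕ → Plane × ℝ) × (ℕ → ℝ) → ℝ≥0∞} (hF : Measurable F) :
    ∫⁻ ω, ENNReal.ofReal (X.servGain n ω) * F (fun i => X.point i ω, fun i => X.crossGain n i ω) ∂P =
      n * ∫⁻ ω, F (fun i => X.point i ω, fun i => X.crossGain n i ω) ∂P := by
  have hZ : Measurable fun ω i => X.point i ω := measurable_pi_lambda _ X.measurable_point
  have hg : Measurable fun ω i => X.crossGain n i ω := measurable_pi_lambda _ (hX.crossGain n)
  have hs := hX.servGain n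
  have hψ : Measurable fun (c : ℕ ⊕ (ℕ × Fin n ⊕ ℕ × Fin n) → ℂ) (i : ℕ) => beamGain
      (fun a => c (.inr (.inl (i, a)))) (mrtPrecoder fun a => c (.inr (.inr (i, a)))) := by
    refine measurable_pi_lambda _ fun i => ?_
    exact measurable_beamGain_mrtPrecoder_comp
      (H := fun a (c : ℕ ⊕ (ℕ × Fin n ⊕ ℕ × Fin n) → ℂ) => c (.inr (.inl (i, a))))
      (W := fun a c => c (.inr (.inr (i, a)))) (fun a => measurable_pi_apply _)
      (fun a => measurable_pi_apply _)
  have hφ : Measurable fun (c : ℕ ⊕ (ℕ × Fin n ⊕ ℕ × Fin n) → ℂ) => beamGain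
      (fun a : Fin n => c (.inl a)) (mrtPrecoder fun a : Fin n => c (.inl a)) := by
    exact measurable_beamGain_mrtPrecoder_comp
      (H := fun a (c : ℕ ⊕ (ℕ × Fin n ⊕ ℕ × Fin n) → ℂ) => c (.inl a))
      (W := fun a c => c (.inl a)) (fun a => measurable_pi_apply _)
      (fun a => measurable_pi_apply _)
  have hi1 : IndepFun (fun ω i => X.point i ω)
      (fun ω => (X.servGain n ω, fun i => X.crossGain n i ω)) P :=
    (X.indep_locations n).comp (φ := id) measurable_id (hφ.prodMk hψ)
  have hi2 : IndepFun (fun ω i => X.point i ω) (fun ω i => X.crossGain n i ω) P :=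
    indepFun_point_crossGain n
  have hi3 : IndepFun (fun ω => X.servGain n ω) (fun ω i => X.crossGain n i ω) P := by
    refine iIndepFun.indepFun_of_measurable_iSup_comap (X.indep_fading n) (hX.fading n)
      (S := range Sum.inl) (T := range Sum.inr) isCompl_range_inl_range_inr.disjoint ?_ ?_
    · exact measurable_beamGain_mrtPrecoder_comp (H := fun a : Fin n => X.serv a)
        (W := fun a => X.serv a)
        (fun a => measurable_iSup_comap (f := X.fading n) (i := .inl a) ⟨a, rfl⟩)
        (fun a => measurable_iSup_comap (f := X.fading n) (i := .inl a) ⟨a, rfl⟩)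
    · refine measurable_pi_of_forall (u := fun i ω => X.crossGain n i ω)
        fun i => (measurable_crossGain_iSup n i).mono ?_ le_rfl
      refine biSup_mono ?_
      rintro c ⟨a, rfl | rfl⟩ <;> simp
  rw [IndepFun.lintegral_comp_prodMk hi1 hZ (hs.prodMk hg)
    (F := fun p => ENNReal.ofReal p.2.1 * F (p.1, p.2.2)) (by fun_prop),
    IndepFun.lintegral_comp_prodMk hi2 hZ hg hF, ← hX.lintegral_servGain n,
    ← lintegral_const_mul']
  · congr with ω
    exact lintegral_mul_eq_lintegral_mul_lintegral_of_indepFun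
      (f := fun ω' => ENNReal.ofReal (X.servGain n ω'))
      (g := fun ω' => F (fun i => X.point i ω, fun i => X.crossGain n i ω')) (by fun_prop)
      (hF.comp (measurable_const.prodMk hg)) (hi3.comp (φ := ENNReal.ofReal) (ψ := fun y => F (fun i => X.point i ω, y))
        (by fun_prop) (by fun_prop))
  · rw [hX.lintegral_servGain]
    simp

theorem ae_tendsto_servGain_div [IsProbabilityMeasure P] :
    ∀ᵐ ω ∂P, Tendsto (fun n : ℕ => X.servGain n ω / n) atTop (𝓝 1) := by
  have hm : ∀ a, Measurable fun ω => ‖X.serv a ω‖ ^ 2 := fun a => by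
    have := hX.serv a
    fun_prop
  have hnn : ∀ a, 0 ≤ᵐ[P] fun ω => ‖X.serv a ω‖ ^ 2 := fun a => ae_of_all _ fun ω => by positivity
  have hint : Integrable (fun ω => ‖X.serv 0 ω‖ ^ 2) P := by
    refine (lintegral_ofReal_ne_top_iff_integrable (hm 0).aestronglyMeasurable (hnn 0)).1 ?_
    rw [hX.lintegral_sq_norm_serv]
    simp
  have hmean : ∫ ω, ‖X.serv 0 ω‖ ^ 2 ∂P = 1 := by
    rw [integral_eq_lintegral_of_nonneg_ae (hnn 0) (hm 0).aestronglyMeasurable,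
      hX.lintegral_sq_norm_serv]
    simp
  -- The serving channel is one sequence shared by all `n`, so its independence can be read off the
  -- network with `0` antennas.
  have hi : iIndepFun (fun a ω => ‖X.serv a ω‖ ^ 2) P :=
    ((X.indep_fading 0).precomp Sum.inl_injective).comp (fun _ z => ‖z‖ ^ 2)
      (fun _ => by fun_prop)
  have := strong_law_ae_real (fun a ω => ‖X.serv a ω‖ ^ 2) hint (fun a b hab => hi.indepFun hab)
    (fun a => IdentDistrib.comp (u := fun z : ℂ => ‖z‖ ^ 2)
      ⟨(X.serv_law a).aemeasurable, (X.serv_law 0).aemeasurable,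
        (X.serv_law a).map_eq.trans (X.serv_law 0).map_eq.symm⟩ (by fun_prop))
  rw [hmean] at this
  filter_upwards [this] with ω hω
  simpa only [X.servGain_eq] using hω

end MeasurableFading

end MISONetwork

/-! ### Inverse second moments of sums of exponential marks -/

theorem lintegral_mul_exp_neg_mul {x : ℝ} (hx : 0 < x) :
    ∫⁻ t in Ioi 0, ENNReal.ofReal (t * Real.exp (-(t * x))) = (ENNReal.ofReal x ^ 2)⁻¹ := by
  have h := Real.integral_rpow_mul_exp_neg_mul_Ioi (a := 2) two_pos hx
  have h2 : ∫ t : ℝ in Ioi 0, t * Real.exp (-(t * x)) = (x ^ 2)⁻¹ := by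
    have h3 : Real.Gamma 2 = 1 := Real.Gamma_two
    rw [h3, mul_one] at h
    norm_num at h
    simpa [mul_comm x] using h
  rw [← ofReal_integral_eq_lintegral_ofReal, h2, ENNReal.ofReal_inv_of_pos (by positivity),
    ENNReal.ofReal_pow hx.le]
  · refine not_imp_comm.1 integral_undef ?_
    rw [h2]
    positivity
  · filter_upwards [ae_restrict_mem measurableSet_Ioi] with t ht
    exact mul_nonneg (le_of_lt ht) (Real.exp_pos _).le

/-- The boundary case `x = 0`, where the left side is infinite, is included so that no positivity of
the random sum is needed; there the integral dominates `(k + 1)²` for every `k`. -/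
theorem inv_sq_le_lintegral_mul_exp {x : ℝ} (hx : 0 ≤ x) :
    (ENNReal.ofReal x ^ 2)⁻¹ ≤ ∫⁻ t in Ioi 0, ENNReal.ofReal (t * Real.exp (-(t * x))) := by
  rcases hx.eq_or_lt with rfl | hx
  · have h : ∀ k : ℕ, ENNReal.ofReal ((k + 1) ^ 2) ≤
        ∫⁻ t in Ioi 0, ENNReal.ofReal (t * Real.exp (-(t * (0 : ℝ)))) := by
      intro k
      have hk : 0 < 1 / ((k : ℝ) + 1) := by positivity
      calc ENNReal.ofReal (((k : ℝ) + 1) ^ 2) = (ENNReal.ofReal (1 / ((k : ℝ) + 1)) ^ 2)⁻¹ := by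
            rw [← ENNReal.ofReal_pow hk.le, ← ENNReal.ofReal_inv_of_pos (by positivity)]
            congr 1
            field_simp
        _ = ∫⁻ t in Ioi 0, ENNReal.ofReal (t * Real.exp (-(t * (1 / ((k : ℝ) + 1))))) :=
            (lintegral_mul_exp_neg_mul hk).symm
        _ ≤ _ := by
            refine setLIntegral_mono' measurableSet_Ioi fun t ht => ?_
            have ht : 0 < t := ht
            apply ENNReal.ofReal_le_ofReal
            gcongr
    have htop : (⊤ : ℝ≥0∞) ≤ ∫⁻ t in Ioi 0, ENNReal.ofReal (t * Real.exp (-(t * (0 : ℝ)))) := by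
      refine le_of_tendsto' (x := atTop) (f := fun k : ℕ => ENNReal.ofReal (((k : ℝ) + 1) ^ 2))
        ?_ h
      refine ENNReal.tendsto_ofReal_atTop.comp ?_
      exact (tendsto_pow_atTop two_ne_zero).comp
        (tendsto_atTop_add_const_right _ _ tendsto_natCast_atTop_atTop)
    exact le_trans le_top htop
  · exact (lintegral_mul_exp_neg_mul hx).ge

/-- The exponent is at least `3`, enough for convergence at infinity; the antiderivative comes from
writing `t = (1 + t) - 1`. -/
theorem lintegral_mul_inv_pow (k : ℕ) :
    ∫⁻ t in Ioi 0, ENNReal.ofReal (t * (1 / (1 + t)) ^ (k + 3)) =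
      ENNReal.ofReal (1 / ((k + 1) * (k + 2))) := by
  have hderiv : ∀ t ∈ Ici (0 : ℝ), HasDerivAt (fun t : ℝ => ((1 + t) ^ (k + 2))⁻¹ / (k + 2) -
      ((1 + t) ^ (k + 1))⁻¹ / (k + 1)) (t * (1 / (1 + t)) ^ (k + 3)) t := by
    intro t ht
    have ht0 : (0 : ℝ) ≤ t := ht
    have h1 : 1 + t ≠ 0 := by positivity
    have hd : HasDerivAt (fun t : ℝ => 1 + t) 1 t := (hasDerivAt_id t).const_add 1
    have h2 := (((hd.pow (k + 2)).inv (pow_ne_zero _ h1)).div_const ((k : ℝ) + 2)).sub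
      (((hd.pow (k + 1)).inv (pow_ne_zero _ h1)).div_const ((k : ℝ) + 1))
    refine HasDerivAt.congr_deriv h2 ?_
    have e1 : (k : ℝ) + 1 ≠ 0 := by positivity
    have e2 : (k : ℝ) + 2 ≠ 0 := by positivity
    simp only [Pi.pow_apply]
    push_cast
    rw [one_div, inv_pow]
    obtain ⟨u, rfl⟩ : ∃ u, t = u - 1 := ⟨t + 1, by ring⟩
    rw [add_sub_cancel] at h1 ⊢
    field_simp
    ring
  have hlim : ∀ m : ℕ, ∀ c : ℝ, Tendsto (fun t : ℝ => ((1 + t) ^ (m + 1))⁻¹ / c) atTop (𝓝 0) := by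
    intro m c
    rw [← zero_div c]
    refine Tendsto.div_const ?_ c
    exact tendsto_inv_atTop_zero.comp ((tendsto_pow_atTop (by simp)).comp
      (tendsto_atTop_add_const_left _ _ tendsto_id))
  have hlim' : Tendsto (fun t : ℝ => ((1 + t) ^ (k + 2))⁻¹ / ((k : ℝ) + 2) -
      ((1 + t) ^ (k + 1))⁻¹ / ((k : ℝ) + 1)) atTop (𝓝 0) := by
    simpa using (hlim (k + 1) _).sub (hlim k _)
  have hpos : ∀ t ∈ Ioi (0 : ℝ), 0 ≤ t * (1 / (1 + t)) ^ (k + 3) := by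
    intro t ht
    have ht0 : (0 : ℝ) < t := ht
    positivity
  rw [← ofReal_integral_eq_lintegral_ofReal
    (integrableOn_Ioi_deriv_of_nonneg' hderiv hpos hlim')
    ((ae_restrict_mem measurableSet_Ioi).mono hpos),
    integral_Ioi_of_hasDerivAt_of_nonneg' hderiv hpos hlim']
  congr 1
  simp
  field_simp
  ring

/-- Writing `x⁻²` as the integral of `t exp(-tx)` and exchanging integrals turns the inverse moment
into a power of the Laplace transform `1 / (1 + t)`. -/
theorem IsExpMarking.lintegral_inv_sq_sum_le {Ω S : Type*} [MeasurableSpace Ω]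
    [MeasurableSpace S] {P : Measure Ω} {Z : ℕ → Ω → S} {g : ℕ → Ω → ℝ} (hg : IsExpMarking P Z g)
    {k : ℕ} {s : Finset ℕ} (hs : s.card = k + 3) :
    ∫⁻ ω, ((∑ i ∈ s, ENNReal.ofReal (g i ω)) ^ 2)⁻¹ ∂P ≤
      ENNReal.ofReal (1 / ((k + 1) * (k + 2))) := by
  have := hg.indep_marks.isProbabilityMeasure
  have hgm := hg.measurable
  calc ∫⁻ ω, ((∑ i ∈ s, ENNReal.ofReal (g i ω)) ^ 2)⁻¹ ∂P
      ≤ ∫⁻ ω, (∫⁻ t in Ioi (0 : ℝ), ENNReal.ofReal (t * Real.exp (-(t * ∑ i ∈ s, g i ω)))) ∂P := by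
        refine lintegral_mono fun ω => ?_
        rw [← ENNReal.ofReal_sum_of_nonneg fun i _ => hg.nonneg i ω]
        exact inv_sq_le_lintegral_mul_exp (Finset.sum_nonneg fun i _ => hg.nonneg i ω)
    _ = ∫⁻ t in Ioi 0, ∫⁻ ω, ENNReal.ofReal (t * Real.exp (-(t * ∑ i ∈ s, g i ω))) ∂P := by
        refine lintegral_lintegral_swap ?_
        exact Measurable.aemeasurable (by fun_prop)
    _ = ∫⁻ t in Ioi 0, ENNReal.ofReal (t * (1 / (1 + t)) ^ (k + 3)) := by
        refine setLIntegral_congr_fun measurableSet_Ioi fun t ht => ?_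
        have ht0 : (0 : ℝ) < t := ht
        have h1 : ∀ ω, ENNReal.ofReal (t * Real.exp (-(t * ∑ i ∈ s, g i ω))) =
            ENNReal.ofReal t * ∏ i ∈ s, ENNReal.ofReal (Real.exp (-(t * g i ω))) := by
          intro ω
          rw [ENNReal.ofReal_mul ht0.le, Finset.mul_sum, ← Finset.sum_neg_distrib, Real.exp_sum,
            ENNReal.ofReal_prod_of_nonneg fun i _ => (Real.exp_pos _).le]
        have hi : iIndepFun (fun i ω => ENNReal.ofReal (Real.exp (-(t * g i ω)))) P :=
          hg.indep_marks.comp (fun _ x => ENNReal.ofReal (Real.exp (-(t * x))))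
            (fun _ => by fun_prop)
        simp_rw [h1]
        rw [lintegral_const_mul' _ _ ENNReal.ofReal_ne_top,
          lintegral_prod_eq_prod_lintegral_of_indepFun s _ hi (fun i => by fun_prop)]
        simp_rw [hg.lintegral_exp _ t (by linarith)]
        rw [Finset.prod_const, hs, ← ENNReal.ofReal_pow (by positivity),
          ← ENNReal.ofReal_mul ht0.le]
    _ = _ := lintegral_mul_inv_pow k

/-! ### Lower bounds on the path loss -/

/-- `M` is non-increasing, so a very small `M r` would make `1 / M²` large on a whole unit interval
beyond `r` and contradict the finiteness of the weighted integral. -/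
theorem PathLossTail.exists_gaussian_lower_bound {L : ℝ → ℝ} (hT : PathLossTail L) :
    ∃ r₀ b c : ℝ, 0 ≤ r₀ ∧ 0 ≤ b ∧ 0 < c ∧ ∀ r, r₀ ≤ r → c * Real.exp (-(b * r ^ 2)) ≤ L r := by
  obtain ⟨r₀, ζ, M, hr₀, -, -, hanti, hMpos, hML, -, lamC, hlamC, hint⟩ := hT
  specialize hint (lamC + 1) (by linarith)
  set φ : ℝ → ℝ := fun r => r / M r ^ 2 * Real.exp (-Real.pi * (lamC + 1) * r ^ 2) with hφ
  set B := ∫ r in Ici r₀, φ r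
  set p := Real.pi * (lamC + 1) with hp
  have hp0 : 0 < p := by positivity
  have hφnn : ∀ r ∈ Ici r₀, 0 ≤ φ r := by
    intro r hr
    have : 0 ≤ r := hr₀.trans hr
    simp only [hφ]
    positivity
  have hB : 0 ≤ B := setIntegral_nonneg measurableSet_Ici hφnn
  refine ⟨r₀, p, Real.sqrt (Real.exp (-(8 * p)) / (B + 1)), hr₀, hp0.le, by positivity,
    fun r hr => le_trans ?_ (hML r hr)⟩
  -- Starting at `r + 1` ensures `s ≥ 1`, so the factor `s` in the integrand can be bounded below by
  -- one.
  have hsub : Icc (r + 1) (r + 2) ⊆ Ici r₀ := fun s hs => le_trans (by linarith) hs.1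
  have h0r : 0 ≤ r := hr₀.trans hr
  have hMr := hMpos r hr
  have h1 : 1 / M r ^ 2 * Real.exp (-(p * (r + 2) ^ 2)) ≤ B := by
    have h2 := setIntegral_ge_of_const_le_real (μ := volume) (s := Icc (r + 1) (r + 2)) (f := φ)
      (c := 1 / M r ^ 2 * Real.exp (-(p * (r + 2) ^ 2))) measurableSet_Icc (by simp) ?_
      (hint.mono_set hsub)
    · rw [Real.volume_real_Icc_of_le (by linarith)] at h2
      have h3 : ∫ s in Icc (r + 1) (r + 2), φ s ≤ B :=
        setIntegral_mono_set hint ((ae_restrict_mem measurableSet_Ici).mono hφnn)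
          (ae_of_all _ hsub)
      calc _ = 1 / M r ^ 2 * Real.exp (-(p * (r + 2) ^ 2)) * (r + 2 - (r + 1)) := by ring
        _ ≤ _ := h2.trans h3
    · intro s hs
      have hs0 : r₀ ≤ s := hsub hs
      have hMs := hMpos s hs0
      have hMsr : M s ≤ M r := hanti hr hs0 (by linarith [hs.1])
      have hs1 : 1 ≤ s := by linarith [hs.1]
      have hs2 : s ≤ r + 2 := hs.2
      simp only [hφ]
      rw [show -Real.pi * (lamC + 1) * s ^ 2 = -(p * s ^ 2) by rw [hp]; ring]
      gcongr
  have h4 : (r + 2) ^ 2 ≤ 2 * r ^ 2 + 8 := by nlinarith [sq_nonneg (r - 2)]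
  have h5 : Real.exp (-(8 * p)) * Real.exp (-(p * r ^ 2)) ^ 2 ≤ Real.exp (-(p * (r + 2) ^ 2)) := by
    rw [← Real.exp_nat_mul, ← Real.exp_add]
    apply Real.exp_le_exp.2
    push_cast
    nlinarith
  have h6 : Real.exp (-(p * (r + 2) ^ 2)) ≤ (B + 1) * M r ^ 2 := by
    rw [div_mul_eq_mul_div, one_mul, div_le_iff₀ (by positivity)] at h1
    nlinarith [sq_nonneg (M r)]
  refine le_of_sq_le_sq ?_ hMr.le
  rw [mul_pow, Real.sq_sqrt (by positivity), div_mul_eq_mul_div, div_le_iff₀ (by positivity)]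
  linarith

theorem PhysicallyFeasible.exists_near_zero {L : ℝ → ℝ} (hL : PhysicallyFeasible L) :
    ∃ δ : ℝ, 0 < δ ∧ ∀ r, 0 ≤ r → r < δ → L 0 / 2 ≤ L r := by
  have h := hL.continuous_zero.eventually (lt_mem_nhds (half_lt_self hL.zero_pos))
  rw [eventually_nhdsWithin_iff, Metric.eventually_nhds_iff] at h
  obtain ⟨δ, hδ, h⟩ := h
  refine ⟨δ, hδ, fun r h0 hr => (h ?_ h0).le⟩
  simpa [abs_of_nonneg h0] using hr

/-! ### Annuli of equal area -/

/-- The annulus `ρ a ≤ ‖x‖² < ρ (a + 1)`. -/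
def annulus (ρ : ℝ) (a : ℕ) : Set Plane := {x | ρ * a ≤ ‖x‖ ^ 2 ∧ ‖x‖ ^ 2 < ρ * (a + 1)}

theorem measurableSet_annulus (ρ : ℝ) (a : ℕ) : MeasurableSet (annulus ρ a) := by
  unfold annulus
  measurability

theorem volume_annulus {ρ : ℝ} (hρ : 0 < ρ) (a : ℕ) :
    volume (annulus ρ a) = ENNReal.ofReal (Real.pi * ρ) := by
  have h : annulus ρ a = Metric.ball 0 (Real.sqrt (ρ * (a + 1))) \
      Metric.ball 0 (Real.sqrt (ρ * a)) := by
    ext x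
    simp only [annulus, mem_ofPred_eq, Set.mem_sdiff, mem_ball_zero_iff, not_lt]
    rw [Real.lt_sqrt (norm_nonneg _), Real.sqrt_le_left (norm_nonneg _)]
    tauto
  rw [h, measure_sdiff (Metric.ball_subset_ball (Real.sqrt_le_sqrt (by nlinarith)))
    measurableSet_ball.nullMeasurableSet measure_ball_lt_top.ne,
    EuclideanSpace.volume_ball_fin_two, EuclideanSpace.volume_ball_fin_two,
    ← ENNReal.ofReal_pow (by positivity), ← ENNReal.ofReal_pow (by positivity),
    Real.sq_sqrt (by positivity), Real.sq_sqrt (by positivity),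
    ← ENNReal.ofReal_mul (by positivity), ← ENNReal.ofReal_mul (by positivity),
    ← ENNReal.ofReal_sub _ (by positivity)]
  congr 1
  ring

theorem norm_lt_of_mem_annulus {ρ : ℝ} (hρ : 0 < ρ) {a b : ℕ} (hab : a < b) {x y : Plane}
    (hx : x ∈ annulus ρ a) (hy : y ∈ annulus ρ b) : ‖x‖ < ‖y‖ := by
  refine lt_of_pow_lt_pow_left₀ 2 (norm_nonneg _) (hx.2.trans_le (le_trans ?_ hy.1))
  have : ((a : ℝ) + 1) ≤ b := by exact_mod_cast hab
  gcongr

theorem disjoint_annulus {ρ : ℝ} (hρ : 0 < ρ) {a b : ℕ} (hab : a ≠ b) :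
    Disjoint (annulus ρ a) (annulus ρ b) := by
  rw [Set.disjoint_left]
  intro x hx hy
  rcases hab.lt_or_gt with h | h
  · exact lt_irrefl _ (norm_lt_of_mem_annulus hρ h hx hy)
  · exact lt_irrefl _ (norm_lt_of_mem_annulus hρ h hy hx)

/-- The path loss is bounded below by a geometric sequence on a sequence of annuli of equal area
that includes two annuli around the origin. -/
theorem exists_annuli_lower_bound {L : ℝ → ℝ} (hL : PhysicallyFeasible L) (hT : PathLossTail L) :
    ∃ (ρ b c : ℝ) (σ : ℕ → ℕ), 0 < ρ ∧ 0 ≤ b ∧ 0 < c ∧ StrictMono σ ∧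
      ∀ j, ∀ x ∈ annulus ρ (σ j), c * Real.exp (-(b * j)) ≤ L ‖x‖ := by
  obtain ⟨r₀, b, c, hr₀, hb, hc, hlow⟩ := hT.exists_gaussian_lower_bound
  obtain ⟨δ, hδ, hnear⟩ := hL.exists_near_zero
  -- With this area parameter, annuli `0` and `1` together are exactly the disc of radius `δ`, where
  -- `L` is at least `L 0 / 2`.
  set ρ := δ ^ 2 / 2 with hρdef
  have hρ : 0 < ρ := by positivity
  set q := ⌈r₀ ^ 2 / ρ⌉₊ with hq
  have hq1 : r₀ ^ 2 ≤ ρ * q := by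
    have := Nat.le_ceil (r₀ ^ 2 / ρ)
    rw [div_le_iff₀ hρ] at this
    linarith
  have hL0 := hL.zero_pos
  refine ⟨ρ, b * ρ, min (L 0 / 2) (c * Real.exp (-(b * (ρ * (q + 1))))),
    -- After the two annuli at the origin, the index jumps by `q` to clear radius `r₀`. The squared
    -- radius is affine in the index, so the Gaussian bound becomes geometric in `j`.
    fun j => if j < 2 then j else j + q, hρ, by positivity, by positivity, ?_, ?_⟩
  · refine strictMono_nat_of_lt_succ fun j => ?_
    split_ifs <;> omega
  · intro j x hx
    by_cases hj : j < 2
    · simp only [hj, if_true] at hx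
      calc _ ≤ L 0 / 2 * 1 := by
            gcongr
            · exact min_le_left _ _
            · rw [Real.exp_le_one_iff]
              have : 0 ≤ b * ρ * j := by positivity
              linarith
        _ ≤ L ‖x‖ := by
            rw [mul_one]
            refine hnear _ (norm_nonneg _) (lt_of_pow_lt_pow_left₀ 2 hδ.le (hx.2.trans_le ?_))
            have : (j : ℝ) ≤ 1 := by exact_mod_cast Nat.lt_succ_iff.1 hj
            nlinarith
    · simp only [hj, if_false] at hx
      have h1 : r₀ ≤ ‖x‖ := by
        refine le_of_sq_le_sq (hq1.trans (le_trans ?_ hx.1)) (norm_nonneg _)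
        gcongr
        simp
      refine le_trans ?_ (hlow _ h1)
      calc _ ≤ c * Real.exp (-(b * (ρ * (q + 1)))) * Real.exp (-(b * ρ * j)) := by
            gcongr
            exact min_le_right _ _
        _ = c * Real.exp (-(b * (ρ * (((j + q : ℕ) : ℝ) + 1)))) := by
            rw [mul_assoc, ← Real.exp_add]
            congr 2
            push_cast
            ring
        _ ≤ _ := by
            gcongr
            exact hx.2.le

/-! ### Interference as a functional of the marked points -/

/-- The distance from the origin to the closest point of level at most `lam`. -/
def nearestDist (lam : ℝ) (z : ℕ → Plane × ℝ) : ℝ :=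
  sInf {r : ℝ | ∃ i, (z i).2 ≤ lam ∧ r = ‖(z i).1‖}

open Classical in
/-- The sum of `L ‖x‖` times the mark over the points `x` of level at most `lam` that are not at
minimal distance from the origin. -/
def totalInterference (L : ℝ → ℝ) (lam : ℝ) (z : ℕ → Plane × ℝ) (y : ℕ → ℝ) : ℝ≥0∞ :=
  ∑' i, if (z i).2 ≤ lam ∧ nearestDist lam z < ‖(z i).1‖ then
    ENNReal.ofReal (L ‖(z i).1‖) * ENNReal.ofReal (y i) else 0

theorem nearestDist_le {lam : ℝ} {z : ℕ → Plane × ℝ} {i : ℕ} (hi : (z i).2 ≤ lam) :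
    nearestDist lam z ≤ ‖(z i).1‖ := by
  refine csInf_le ⟨0, ?_⟩ ⟨i, hi, rfl⟩
  rintro _ ⟨j, -, rfl⟩
  exact norm_nonneg _

theorem nearestDist_nonneg (lam : ℝ) (z : ℕ → Plane × ℝ) : 0 ≤ nearestDist lam z := by
  refine Real.sInf_nonneg ?_
  rintro _ ⟨j, -, rfl⟩
  exact norm_nonneg _

theorem measurable_nearestDist (lam : ℝ) : Measurable (nearestDist lam) := by
  refine measurable_of_Iio fun a => ?_
  -- The second set accounts for the default `sInf ∅ = 0` when no point has level at most `lam`.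
  have h : nearestDist lam ⁻¹' Iio a = (⋃ i, {z | (z i).2 ≤ lam ∧ ‖(z i).1‖ < a}) ∪
      {z | (∀ i, lam < (z i).2) ∧ 0 < a} := by
    ext z
    simp only [mem_preimage, mem_Iio, mem_union, mem_iUnion, mem_ofPred_eq]
    by_cases hz : ∃ i, (z i).2 ≤ lam
    · have hne : {r : ℝ | ∃ i, (z i).2 ≤ lam ∧ r = ‖(z i).1‖}.Nonempty :=
        hz.imp' (fun i => ‖(z i).1‖) fun i hi => ⟨i, hi, rfl⟩
      constructor
      · intro h
        obtain ⟨_, ⟨i, hi, rfl⟩, hlt⟩ := exists_lt_of_csInf_lt hne h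
        exact Or.inl ⟨i, hi, hlt⟩
      · rintro (⟨i, hi, hlt⟩ | ⟨h, -⟩)
        · exact (nearestDist_le hi).trans_lt hlt
        · obtain ⟨i, hi⟩ := hz
          exact absurd (h i) (not_lt.2 hi)
    · push Not at hz
      have he : {r : ℝ | ∃ i, (z i).2 ≤ lam ∧ r = ‖(z i).1‖} = ∅ := by
        refine eq_empty_of_forall_notMem ?_
        rintro r ⟨i, hi, -⟩
        exact absurd (hz i) (not_lt.2 hi)
      rw [nearestDist, he, Real.sInf_empty]
      constructor
      · exact fun h => Or.inr ⟨hz, h⟩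
      · rintro (⟨i, hi, -⟩ | ⟨-, h⟩)
        · exact absurd (hz i) (not_lt.2 hi)
        · exact h
  rw [h]
  refine (MeasurableSet.iUnion fun i => ?_).union ?_
  · have h1 : MeasurableSet {z : ℕ → Plane × ℝ | (z i).2 ≤ lam} :=
      measurableSet_le (by fun_prop) measurable_const
    have h2 : MeasurableSet {z : ℕ → Plane × ℝ | ‖(z i).1‖ < a} :=
      measurableSet_lt (by fun_prop) measurable_const
    exact h1.inter h2
  · have h1 : ∀ i, MeasurableSet {z : ℕ → Plane × ℝ | lam < (z i).2} := fun i =>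
      measurableSet_lt measurable_const (by fun_prop)
    simp only [ofPred_and, ofPred_forall]
    exact (MeasurableSet.iInter h1).inter (MeasurableSet.const _)

theorem measurable_totalInterference {L : ℝ → ℝ} (hL : Measurable L) (lam : ℝ) :
    Measurable fun p : (ℕ → Plane × ℝ) × (ℕ → ℝ) => totalInterference L lam p.1 p.2 := by
  have := measurable_nearestDist lam
  refine Measurable.tsum fun i => Measurable.ite ?_ (by fun_prop) measurable_const
  have h1 : MeasurableSet {p : (ℕ → Plane × ℝ) × (ℕ → ℝ) | (p.1 i).2 ≤ lam} :=
    measurableSet_le (by fun_prop) measurable_const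
  have h2 : MeasurableSet {p : (ℕ → Plane × ℝ) × (ℕ → ℝ) | nearestDist lam p.1 < ‖(p.1 i).1‖} :=
    measurableSet_lt (by fun_prop) (by fun_prop)
  exact h1.inter h2

/-- The point `i₀` witnesses that no point of `s` is nearest to the origin, so all of them
interfere. -/
theorem mul_sum_le_totalInterference {L : ℝ → ℝ} {lam l : ℝ} {z : ℕ → Plane × ℝ} {y : ℕ → ℝ}
    {i₀ : ℕ} (h₀ : (z i₀).2 ≤ lam) {s : Finset ℕ} (hs : ∀ i ∈ s, (z i).2 ≤ lam)
    (hlt : ∀ i ∈ s, ‖(z i₀).1‖ < ‖(z i).1‖) (hl : ∀ i ∈ s, l ≤ L ‖(z i).1‖) :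
    ENNReal.ofReal l * ∑ i ∈ s, ENNReal.ofReal (y i) ≤ totalInterference L lam z y := by
  classical
  refine le_trans ?_ (ENNReal.sum_le_tsum s)
  rw [Finset.mul_sum]
  refine Finset.sum_le_sum fun i hi => ?_
  rw [if_pos ⟨hs i hi, (nearestDist_le h₀).trans_lt (hlt i hi)⟩]
  gcongr
  exact hl i hi

/-- The intensity measure of the locations and levels of the base stations. -/
abbrev networkIntensity : Measure (Plane × ℝ) :=
  (volume : Measure Plane).prod ((volume : Measure ℝ).restrict (Ici 0))

theorem networkIntensity_prod_Iic (A : Set Plane) {lam : ℝ} :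
    networkIntensity (A ×ˢ Iic lam) = volume A * ENNReal.ofReal lam := by
  rw [networkIntensity, Measure.prod_prod, Measure.restrict_apply measurableSet_Iic, inter_comm,
    Ici_inter_Iic, Real.volume_Icc, sub_zero]

/-! ### Inverse second moment of the interference -/

section InverseMoment

variable {Ω : Type*} [MeasurableSpace Ω] {P : Measure Ω} {Z : ℕ → Ω → Plane × ℝ}

/-- Each of the events that at least `K` points lie in one of the first `m` even regions, and in
one of the first `m` odd regions. -/
def crowded {S : Type*} (A : ℕ → Set S) (K m : ℕ) : Set (ℕ → S) :=
  {z | (∃ j < m, (K : ℕ∞) ≤ pointCount z (A (2 * j))) ∧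
    ∃ j < m, (K : ℕ∞) ≤ pointCount z (A (2 * j + 1))}

theorem measure_forall_pointCount_lt_le {S : Type*} [MeasurableSpace S] {Z : ℕ → Ω → S}
    {ν : Measure S} (hP : IsPoissonPointProcess P Z ν) {A : ℕ → Set S}
    (hA : ∀ j, MeasurableSet (A j)) {μ : ℝ} (hν : ∀ j, ν (A j) = ENNReal.ofReal μ) (hμ : 0 ≤ μ)
    (hd : Pairwise fun i j => Disjoint (A i) (A j)) {K : ℕ} (hK : (K : ℝ) ≤ μ / 4) (m : ℕ) :
    P {ω | ∀ j < m, pointCount (fun i => Z i ω) (A j) < K} ≤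
      ENNReal.ofReal (Real.exp (-(μ / 4))) ^ m := by
  have hi := hP.indep_count m (fun j => A j) (fun j => hA j) (fun j => by simp [hν])
    (fun i j hij => hd (fun h => hij (Fin.ext h)))
  have hint := hi.meas_iInter (s := fun j : Fin m => {ω | pointCount (fun i => Z i ω) (A j) < K})
    (fun j => ⟨{k | k < (K : ℕ∞)}, MeasurableSet.of_discrete, rfl⟩)
  have heq : {ω | ∀ j < m, pointCount (fun i => Z i ω) (A j) < K} =
      ⋂ j : Fin m, {ω | pointCount (fun i => Z i ω) (A j) < K} := by
    ext ω
    simp [Fin.forall_iff]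
  rw [heq, hint]
  calc _ ≤ ∏ _j : Fin m, ENNReal.ofReal (Real.exp (-(μ / 4))) := by
        refine Finset.prod_le_prod' fun j _ => ?_
        have := hP.measure_pointCount_lt (hA j) (by simp [hν]) (K := K)
          (by rw [hν, ENNReal.toReal_ofReal hμ]; exact hK)
        rwa [hν, ENNReal.toReal_ofReal hμ] at this
    _ = _ := by simp

theorem measure_not_crowded_le {S : Type*} [MeasurableSpace S] {Z : ℕ → Ω → S}
    {ν : Measure S} (hP : IsPoissonPointProcess P Z ν) {A : ℕ → Set S}
    (hA : ∀ j, MeasurableSet (A j)) {μ : ℝ} (hν : ∀ j, ν (A j) = ENNReal.ofReal μ) (hμ : 0 ≤ μ)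
    (hd : Pairwise fun i j => Disjoint (A i) (A j)) {K : ℕ} (hK : (K : ℝ) ≤ μ / 4) (m : ℕ) :
    P {ω | (fun i => Z i ω) ∉ crowded A K m} ≤ 2 * ENNReal.ofReal (Real.exp (-(μ / 4))) ^ m := by
  have h0 := measure_forall_pointCount_lt_le hP (fun j => hA (2 * j)) (fun j => hν _) hμ
    (fun i j hij => hd (by omega)) hK m
  have h1 := measure_forall_pointCount_lt_le hP (fun j => hA (2 * j + 1)) (fun j => hν _) hμ
    (fun i j hij => hd (by omega)) hK m
  rw [two_mul]
  refine le_trans (measure_mono ?_) ((measure_union_le _ _).trans (add_le_add h0 h1))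
  intro ω hω
  simp only [crowded, mem_ofPred_eq, not_and_or, not_exists, not_le, ← imp_iff_not_or] at hω
  exact hω

theorem measurableSet_crowded {S : Type*} [MeasurableSpace S] {Z : ℕ → Ω → S}
    (hZ : ∀ i, Measurable (Z i)) {A : ℕ → Set S} (hA : ∀ j, MeasurableSet (A j)) (K m : ℕ) :
    MeasurableSet {ω | (fun i => Z i ω) ∈ crowded A K m} := by
  have h : ∀ j, MeasurableSet {ω | (K : ℕ∞) ≤ pointCount (fun i => Z i ω) (A j)} := by
    intro j
    have := measurableSet_le (measurable_const (a := (K : ℝ≥0∞))) (measurable_pointCount hZ (hA j))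
    convert this using 3 with ω
    rw [← ENat.toENNReal_coe, ENat.toENNReal_le]
  have heq : {ω | (fun i => Z i ω) ∈ crowded A K m} =
      (⋃ j, {ω | j < m} ∩ {ω | (K : ℕ∞) ≤ pointCount (fun i => Z i ω) (A (2 * j))}) ∩
        ⋃ j, {ω | j < m} ∩ {ω | (K : ℕ∞) ≤ pointCount (fun i => Z i ω) (A (2 * j + 1))} := by
    ext ω
    simp [crowded]
  rw [heq]
  exact (MeasurableSet.iUnion fun j => (MeasurableSet.const _).inter (h _)).inter
    (MeasurableSet.iUnion fun j => (MeasurableSet.const _).inter (h _))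

/-- On the crowded events, the interference dominates a multiple of a sum of many marks. -/
theorem exists_mul_sum_le_totalInterference {L : ℝ → ℝ} {ρ b c lam : ℝ} {σ : ℕ → ℕ} (hρ : 0 < ρ)
    (hb : 0 ≤ b) (hc : 0 < c) (hσ : StrictMono σ)
    (hlow : ∀ j, ∀ x ∈ annulus ρ (σ j), c * Real.exp (-(b * j)) ≤ L ‖x‖) {K m : ℕ} (hK : 1 ≤ K)
    {z : ℕ → Plane × ℝ} (hz : z ∈ crowded (fun j => annulus ρ (σ j) ×ˢ Iic lam) K m) :
    ∃ s : Finset ℕ, s.card = K ∧ ∀ y : ℕ → ℝ, ENNReal.ofReal (c * Real.exp (-(b * (2 * m)))) *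
      ∑ i ∈ s, ENNReal.ofReal (y i) ≤ totalInterference L lam z y := by
  -- Any point of the inner region serves as the closer point, and the outer region supplies the `K`
  -- interferers. An even and an odd index always differ, so one region is inner.
  have key : ∀ i j, i < j → j < 2 * m →
      (K : ℕ∞) ≤ pointCount z (annulus ρ (σ i) ×ˢ Iic lam) →
      (K : ℕ∞) ≤ pointCount z (annulus ρ (σ j) ×ˢ Iic lam) →
      ∃ s : Finset ℕ, s.card = K ∧ ∀ y : ℕ → ℝ, ENNReal.ofReal (c * Real.exp (-(b * (2 * m)))) *
        ∑ i ∈ s, ENNReal.ofReal (y i) ≤ totalInterference L lam z y := by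
    intro i j hij hjm hi hj
    obtain ⟨t, htK, ht⟩ := (le_pointCount_iff _ _ _).1 hi
    obtain ⟨s, hsK, hs⟩ := (le_pointCount_iff _ _ _).1 hj
    obtain ⟨i₀, hi₀⟩ : t.Nonempty := Finset.card_pos.1 (by omega)
    refine ⟨s, hsK, fun y => mul_sum_le_totalInterference (i₀ := i₀) (ht _ hi₀).2
      (fun k hk => (hs k hk).2)
      (fun k hk => norm_lt_of_mem_annulus hρ (hσ hij) (ht _ hi₀).1 (hs k hk).1)
      (fun k hk => le_trans ?_ (hlow j _ (hs k hk).1))⟩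
    have : (j : ℝ) ≤ 2 * m := by exact_mod_cast hjm.le
    gcongr
  obtain ⟨⟨i, him, hi⟩, j, hjm, hj⟩ := hz
  rcases lt_or_gt_of_ne (show 2 * i ≠ 2 * j + 1 by omega) with h | h
  · exact key _ _ h (by omega) hi hj
  · exact key _ _ h (by omega) hj hi

/-- Conditionally on the points, decompose by the first `m + 1` at which the configuration is
crowded. The `m`th term is the probability of not being crowded at `m`, times the inverse moment
with the weakest path loss allowed at `m + 1`. -/
theorem lintegral_inv_sq_totalInterference_le_tsum [IsProbabilityMeasure P]
    (hP : IsPoissonPointProcess P Z networkIntensity) {L : ℝ → ℝ} (hL : Measurable L)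
    {ρ b c lam : ℝ} {σ : ℕ → ℕ} (hρ : 0 < ρ) (hb : 0 ≤ b) (hc : 0 < c) (hσ : StrictMono σ)
    (hlow : ∀ j, ∀ x ∈ annulus ρ (σ j), c * Real.exp (-(b * j)) ≤ L ‖x‖) (hlam : 0 < lam) {k : ℕ}
    (hk : ((k + 3 : ℕ) : ℝ) ≤ Real.pi * ρ * lam / 4) {g : ℕ → Ω → ℝ} (hg : IsExpMarking P Z g) :
    ∫⁻ ω, (totalInterference L lam (fun i => Z i ω) (fun i => g i ω) ^ 2)⁻¹ ∂P ≤
      ∑' m : ℕ, 2 * ENNReal.ofReal (Real.exp (-(Real.pi * ρ * lam / 4))) ^ m *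
        ((ENNReal.ofReal (c * Real.exp (-(b * (2 * (m + 1 : ℕ))))) ^ 2)⁻¹ *
          ENNReal.ofReal (1 / ((k + 1) * (k + 2)))) := by
  set A : ℕ → Set (Plane × ℝ) := fun j => annulus ρ (σ j) ×ˢ Iic lam with hAdef
  have hA : ∀ j, MeasurableSet (A j) := fun j =>
    (measurableSet_annulus ρ _).prod measurableSet_Iic
  have hν : ∀ j, networkIntensity (A j) = ENNReal.ofReal (Real.pi * ρ * lam) := fun j => by
    rw [hAdef, networkIntensity_prod_Iic, volume_annulus hρ, ← ENNReal.ofReal_mul (by positivity)]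
  have hd : Pairwise fun i j => Disjoint (A i) (A j) := fun i j hij =>
    (disjoint_annulus hρ (hσ.injective.ne hij)).set_prod_left _ _
  have hμ : 0 < Real.pi * ρ * lam := by positivity
  have hnot : ∀ m, P {ω | (fun i => Z i ω) ∉ crowded A (k + 3) m} ≤
      2 * ENNReal.ofReal (Real.exp (-(Real.pi * ρ * lam / 4))) ^ m :=
    measure_not_crowded_le hP hA hν hμ.le hd hk
  set C : ℕ → ℝ≥0∞ := fun m => (ENNReal.ofReal (c * Real.exp (-(b * (2 * m)))) ^ 2)⁻¹ *
    ENNReal.ofReal (1 / ((k + 1) * (k + 2))) with hC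
  have hmeasZ : Measurable fun ω i => Z i ω := measurable_pi_lambda _ hP.measurable
  have hmeasg : Measurable fun ω i => g i ω := measurable_pi_lambda _ hg.measurable
  rw [IndepFun.lintegral_comp_prodMk hg.indep_points hmeasZ hmeasg
    (F := fun p => (totalInterference L lam p.1 p.2 ^ 2)⁻¹)
    ((measurable_totalInterference hL lam).pow_const 2).inv]
  have hcond : ∀ m ω, (fun i => Z i ω) ∈ crowded A (k + 3) m →
      ∫⁻ ω', (totalInterference L lam (fun i => Z i ω) (fun i => g i ω') ^ 2)⁻¹ ∂P ≤ C m := by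
    intro m ω hω
    obtain ⟨s, hs, hle⟩ := exists_mul_sum_le_totalInterference hρ hb hc hσ hlow (by omega) hω
    have hl : ENNReal.ofReal (c * Real.exp (-(b * (2 * m)))) ^ 2 ≠ 0 :=
      pow_ne_zero _ (ENNReal.ofReal_pos.2 (by positivity)).ne'
    calc _ ≤ ∫⁻ ω', (ENNReal.ofReal (c * Real.exp (-(b * (2 * m)))) ^ 2)⁻¹ *
          ((∑ i ∈ s, ENNReal.ofReal (g i ω')) ^ 2)⁻¹ ∂P := by
          refine lintegral_mono fun ω' => ?_
          dsimp only
          rw [← ENNReal.mul_inv (Or.inl hl) (Or.inl (by finiteness)), ← mul_pow]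
          refine ENNReal.inv_le_inv.2 ?_
          exact pow_le_pow_left' (hle _) 2
      _ ≤ C m := by
          rw [lintegral_const_mul' _ _ (ENNReal.inv_ne_top.2 hl)]
          exact mul_le_mul_right (hg.lintegral_inv_sq_sum_le hs) _
  have hae : ∀ᵐ ω ∂P, ∃ m, (fun i => Z i ω) ∈ crowded A (k + 3) m := by
    have hq : ENNReal.ofReal (Real.exp (-(Real.pi * ρ * lam / 4))) < 1 := by
      rw [← ENNReal.ofReal_one, ENNReal.ofReal_lt_ofReal_iff one_pos, Real.exp_lt_one_iff]
      linarith
    have hlim : Tendsto (fun m : ℕ => 2 *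
        ENNReal.ofReal (Real.exp (-(Real.pi * ρ * lam / 4))) ^ m) atTop (𝓝 0) := by
      have := ENNReal.Tendsto.const_mul (a := 2) (ENNReal.tendsto_pow_atTop_nhds_zero_of_lt_one hq)
        (Or.inr (by simp))
      simpa using this
    rw [ae_iff]
    refine le_antisymm (ge_of_tendsto' hlim fun m => le_trans (measure_mono ?_) (hnot m)) zero_le
    intro ω hω hm
    exact hω ⟨m, hm⟩
  -- This makes the first crowded index positive, so it has a predecessor at which crowding fails.
  have hcr0 : ∀ z, z ∉ crowded A (k + 3) 0 := fun z hz => by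
    obtain ⟨⟨j, hj, -⟩, -⟩ := hz
    exact absurd hj (Nat.not_lt_zero j)
  calc _ ≤ ∫⁻ ω, ∑' m, {ω | (fun i => Z i ω) ∉ crowded A (k + 3) m}.indicator
        (fun _ => C (m + 1)) ω ∂P := by
        refine lintegral_mono_ae ?_
        filter_upwards [hae] with ω hω
        classical
        obtain ⟨m, hm⟩ : ∃ m, Nat.find hω = m + 1 := by
          refine Nat.exists_eq_succ_of_ne_zero fun h0 => ?_
          exact hcr0 _ (h0 ▸ Nat.find_spec hω)
        have h1 : (fun i => Z i ω) ∈ crowded A (k + 3) (m + 1) := hm ▸ Nat.find_spec hω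
        have h2 : (fun i => Z i ω) ∉ crowded A (k + 3) m := Nat.find_min hω (by omega)
        refine (hcond _ _ h1).trans (le_trans ?_ (ENNReal.le_tsum m))
        rw [indicator_of_mem (show ω ∈ {ω | (fun i => Z i ω) ∉ crowded A (k + 3) m} from h2)]
    _ = ∑' m, C (m + 1) * P {ω | (fun i => Z i ω) ∉ crowded A (k + 3) m} := by
        have hms : ∀ m, MeasurableSet {ω | (fun i => Z i ω) ∉ crowded A (k + 3) m} := fun m =>
          (measurableSet_crowded hP.measurable hA _ m).compl
        rw [lintegral_tsum fun m => (measurable_const.indicator (hms m)).aemeasurable]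
        congr with m
        rw [lintegral_indicator_const (hms m)]
    _ ≤ _ := by
        refine ENNReal.tsum_le_tsum fun m => ?_
        rw [mul_comm]
        gcongr
        exact hnot m

theorem exists_lintegral_inv_sq_totalInterference_le [IsProbabilityMeasure P]
    (hP : IsPoissonPointProcess P Z networkIntensity) {L : ℝ → ℝ} (hL : PhysicallyFeasible L)
    (hT : PathLossTail L) :
    ∃ C : ℝ, 0 ≤ C ∧ ∀ᶠ lam in atTop, ∀ g : ℕ → Ω → ℝ, IsExpMarking P Z g →
      ∫⁻ ω, (totalInterference L lam (fun i => Z i ω) (fun i => g i ω) ^ 2)⁻¹ ∂P ≤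
        ENNReal.ofReal (C / lam ^ 2) := by
  obtain ⟨ρ, b, c, σ, hρ, hb, hc, hσ, hlow⟩ := exists_annuli_lower_bound hL hT
  -- `256 = 2 * 64 * 2`: the union over even and odd regions, the bound `64 / μ²` on the inverse
  -- moment, and the geometric series of ratio `1/2`. The factor `exp(4b)` comes from the shift to
  -- `m + 1`.
  refine ⟨256 * Real.exp (4 * b) / (c ^ 2 * (Real.pi * ρ) ^ 2), by positivity, ?_⟩
  have hπρ : 0 < Real.pi * ρ := by positivity
  have h1 : Tendsto (fun lam => Real.pi * ρ * lam) atTop atTop := tendsto_id.const_mul_atTop hπρ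
  have h2 : ∀ᶠ lam in atTop, Real.exp (-(Real.pi * ρ * lam / 4)) * Real.exp (4 * b) < 1 / 2 := by
    have h3 : Tendsto (fun lam => Real.exp (-(Real.pi * ρ * lam / 4)) * Real.exp (4 * b)) atTop
        (𝓝 (0 * Real.exp (4 * b))) :=
      (Real.tendsto_exp_neg_atTop_nhds_zero.comp (h1.atTop_div_const (by norm_num))).mul_const _
    rw [zero_mul] at h3
    exact h3.eventually (gt_mem_nhds (by norm_num))
  -- The threshold `24` makes `μ/4 - 3 ≥ μ/8`, so `k + 1` is still of order `μ` after three marks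
  -- are spent on convergence.
  filter_upwards [h2, h1.eventually_ge_atTop 24, eventually_gt_atTop 0] with lam hq hμ hlam g hg
  set μ := Real.pi * ρ * lam with hμdef
  obtain ⟨k, hk⟩ : ∃ k, ⌊μ / 4⌋₊ = k + 3 := by
    refine ⟨⌊μ / 4⌋₊ - 3, ?_⟩
    have : 3 ≤ ⌊μ / 4⌋₊ := Nat.le_floor (by push_cast; linarith)
    omega
  have hk1 : ((k + 3 : ℕ) : ℝ) ≤ μ / 4 := by
    rw [← hk]
    exact Nat.floor_le (by linarith)
  have hk2 : μ / 8 ≤ k + 1 := by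
    have := Nat.lt_floor_add_one (μ / 4)
    rw [hk] at this
    push_cast at this
    linarith
  have hkk : 1 / (((k : ℝ) + 1) * (k + 2)) ≤ 64 / μ ^ 2 := by
    rw [div_le_div_iff₀ (by positivity) (by positivity)]
    have : μ ^ 2 / 64 ≤ (k + 1) * (k + 2) := by
      calc μ ^ 2 / 64 = (μ / 8) * (μ / 8) := by ring
        _ ≤ _ := by
          gcongr
          linarith
    linarith
  refine (lintegral_inv_sq_totalInterference_le_tsum hP hL.measurable hρ hb hc hσ hlow hlam hk1
    hg).trans ?_
  have hterm : ∀ m : ℕ, 2 * ENNReal.ofReal (Real.exp (-(μ / 4))) ^ m *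
        ((ENNReal.ofReal (c * Real.exp (-(b * (2 * (m + 1 : ℕ))))) ^ 2)⁻¹ *
          ENNReal.ofReal (1 / ((k + 1) * (k + 2)))) ≤
      ENNReal.ofReal (128 * Real.exp (4 * b) / (c ^ 2 * μ ^ 2)) * ENNReal.ofReal (1 / 2) ^ m := by
    intro m
    rw [← ENNReal.ofReal_pow (by positivity), ← ENNReal.ofReal_pow (by positivity),
      ← ENNReal.ofReal_pow (by positivity), ← ENNReal.ofReal_inv_of_pos (by positivity),
      show (2 : ℝ≥0∞) = ENNReal.ofReal 2 by simp, ← ENNReal.ofReal_mul (by positivity),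
      ← ENNReal.ofReal_mul (by positivity), ← ENNReal.ofReal_mul (by positivity),
      ← ENNReal.ofReal_mul (by positivity)]
    apply ENNReal.ofReal_le_ofReal
    have e1 : ((c * Real.exp (-(b * (2 * (m + 1 : ℕ))))) ^ 2)⁻¹ =
        Real.exp (4 * b) * Real.exp (4 * b) ^ m / c ^ 2 := by
      rw [mul_pow, ← Real.exp_nat_mul, mul_inv, ← Real.exp_neg, ← Real.exp_nat_mul, ← Real.exp_add]
      push_cast
      rw [div_eq_mul_inv, mul_comm]
      congr 2
      ring
    rw [e1]
    calc _ = 2 * Real.exp (4 * b) / c ^ 2 * ((Real.exp (-(μ / 4)) * Real.exp (4 * b)) ^ m) *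
          (1 / ((k + 1) * (k + 2))) := by
          rw [mul_pow]
          ring
      _ ≤ 2 * Real.exp (4 * b) / c ^ 2 * ((1 / 2) ^ m) * (64 / μ ^ 2) := by gcongr
      _ = _ := by
          field_simp
          norm_num
  refine (ENNReal.tsum_le_tsum hterm).trans (le_of_eq ?_)
  rw [ENNReal.tsum_mul_left, ENNReal.tsum_geometric,
    show (1 : ℝ≥0∞) - ENNReal.ofReal (1 / 2) = ENNReal.ofReal (1 / 2) by
      rw [← ENNReal.ofReal_one, ← ENNReal.ofReal_sub _ (by norm_num)]; norm_num,
    ← ENNReal.ofReal_inv_of_pos (by norm_num), ← ENNReal.ofReal_mul (by positivity)]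
  congr 1
  rw [hμdef]
  field_simp
  norm_num

end InverseMoment

/-! ### Laws of large numbers for sums over the points of bounded level -/

open Classical in
/-- The sum of `ψ x` times the mark over the points `x` of level at most `lam`. -/
def levelSum (ψ : Plane → ℝ≥0∞) (lam : ℝ) (z : ℕ → Plane × ℝ) (y : ℕ → ℝ) : ℝ≥0∞ :=
  ∑' i, (if (z i).2 ≤ lam then ψ (z i).1 else 0) * ENNReal.ofReal (y i)

theorem levelSum_mono (ψ : Plane → ℝ≥0∞) (z : ℕ → Plane × ℝ) (y : ℕ → ℝ) :
    Monotone fun lam => levelSum ψ lam z y := by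
  intro a b hab
  refine ENNReal.tsum_le_tsum fun i => ?_
  gcongr
  split_ifs with h1 h2
  · exact le_rfl
  · exact absurd (h1.trans hab) h2
  · exact zero_le
  · exact le_rfl

theorem measurable_ite_level {ψ : Plane → ℝ≥0∞} (hψ : Measurable ψ) (lam : ℝ) :
    Measurable fun x : Plane × ℝ => if x.2 ≤ lam then ψ x.1 else 0 :=
  Measurable.ite (measurableSet_le (by fun_prop) measurable_const) (by fun_prop) measurable_const

theorem lintegral_ite_level {ψ : Plane → ℝ≥0∞} (hψ : Measurable ψ) (lam : ℝ) :
    ∫⁻ x : Plane × ℝ, (if x.2 ≤ lam then ψ x.1 else 0) ∂networkIntensity =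
      (∫⁻ x, ψ x) * ENNReal.ofReal lam := by
  have h := lintegral_prod_mul (μ := (volume : Measure Plane))
    (ν := (volume : Measure ℝ).restrict (Ici 0)) (f := ψ) (g := (Iic lam).indicator fun _ => 1)
    hψ.aemeasurable (measurable_const.indicator measurableSet_Iic).aemeasurable
  rw [lintegral_indicator measurableSet_Iic, setLIntegral_one,
    Measure.restrict_apply measurableSet_Iic, inter_comm, Ici_inter_Iic, Real.volume_Icc,
    sub_zero] at h
  rw [← h]
  congr with x
  by_cases hx : x.2 ≤ lam <;> simp [hx]

section Limits

variable {Ω : Type*} [MeasurableSpace Ω] {P : Measure Ω} {Z : ℕ → Ω → Plane × ℝ}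

theorem lintegral_levelSum (hP : IsPoissonPointProcess P Z networkIntensity) {g : ℕ → Ω → ℝ}
    (hg : IsExpMarking P Z g) {ψ : Plane → ℝ≥0∞} (hψ : Measurable ψ) (lam : ℝ) :
    ∫⁻ ω, levelSum ψ lam (fun i => Z i ω) (fun i => g i ω) ∂P =
      (∫⁻ x, ψ x) * ENNReal.ofReal lam := by
  rw [← lintegral_ite_level hψ lam]
  exact hg.lintegral_markedSum hP.measurable hP (measurable_ite_level hψ lam)

theorem measurable_levelSum (hP : IsPoissonPointProcess P Z networkIntensity) {g : ℕ → Ω → ℝ}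
    (hg : ∀ i, Measurable (g i)) {ψ : Plane → ℝ≥0∞} (hψ : Measurable ψ) (lam : ℝ) :
    Measurable fun ω => levelSum ψ lam (fun i => Z i ω) (fun i => g i ω) :=
  IsExpMarking.measurable_markedSum hP.measurable hg (measurable_ite_level hψ lam)

/-- The second-moment bound gives variance at most `17 B ∫ψ / lam k`. The marks may change with `k`
in an arbitrary joint way, since only the marginal bounds are summed. -/
theorem ae_tendsto_levelSum_div [IsProbabilityMeasure P]
    (hP : IsPoissonPointProcess P Z networkIntensity) {g : ℕ → ℕ → Ω → ℝ}
    (hg : ∀ k, IsExpMarking P Z (g k)) {ψ : Plane → ℝ≥0∞} (hψ : Measurable ψ) {B : ℝ≥0∞}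
    (hB : B ≠ ∞) (hψB : ∀ x, ψ x ≤ B) (hψint : ∫⁻ x, ψ x ≠ ∞) {lam : ℕ → ℝ}
    (hlam : ∀ k, 0 < lam k) (hsum : ∑' k, (ENNReal.ofReal (lam k))⁻¹ ≠ ∞) :
    ∀ᵐ ω ∂P, Tendsto (fun k => levelSum ψ (lam k) (fun i => Z i ω) (fun i => g k i ω) /
      ENNReal.ofReal (lam k)) atTop (𝓝 (∫⁻ x, ψ x)) := by
  have h0 : ∀ k, ENNReal.ofReal (lam k) ≠ 0 := fun k => (ENNReal.ofReal_pos.2 (hlam k)).ne'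
  have ht : ∀ k, ENNReal.ofReal (lam k) ≠ ∞ := fun k => ENNReal.ofReal_ne_top
  refine ae_tendsto_of_summable_variance
    (v := fun k => 17 * B * (∫⁻ x, ψ x) * (ENNReal.ofReal (lam k))⁻¹)
    (fun k => (measurable_levelSum hP (hg k).measurable hψ _).div_const _) hψint ?_ ?_ ?_
  · rw [ENNReal.tsum_mul_left]
    finiteness
  · intro k
    simp_rw [div_eq_mul_inv]
    rw [lintegral_mul_const' _ _ (ENNReal.inv_ne_top.2 (h0 k)), lintegral_levelSum hP (hg k) hψ,
      mul_assoc, ENNReal.mul_inv_cancel (h0 k) (ht k), mul_one]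
  · intro k
    have h2 := (hg k).lintegral_markedSum_sq_le hP.measurable hP (measurable_ite_level hψ (lam k))
    have h3 : ∫⁻ x : Plane × ℝ, (if x.2 ≤ lam k then ψ x.1 else 0) *
        (if x.2 ≤ lam k then ψ x.1 else 0) ∂networkIntensity ≤
        B * ((∫⁻ x, ψ x) * ENNReal.ofReal (lam k)) := by
      rw [← lintegral_ite_level hψ, ← lintegral_const_mul' _ _ hB]
      refine lintegral_mono fun x => ?_
      dsimp only
      gcongr
      split_ifs
      · exact hψB _
      · exact zero_le
    rw [lintegral_ite_level hψ] at h2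
    have h4 : ∫⁻ ω, levelSum ψ (lam k) (fun i => Z i ω) (fun i => g k i ω) ^ 2 ∂P ≤
        ((∫⁻ x, ψ x) * ENNReal.ofReal (lam k)) ^ 2 +
          17 * (B * ((∫⁻ x, ψ x) * ENNReal.ofReal (lam k))) := by
      refine le_trans h2 ?_
      gcongr
    simp_rw [div_eq_mul_inv, mul_pow]
    rw [lintegral_mul_const' _ _ (by have := h0 k; finiteness)]
    calc _ ≤ (((∫⁻ x, ψ x) * ENNReal.ofReal (lam k)) ^ 2 +
          17 * (B * ((∫⁻ x, ψ x) * ENNReal.ofReal (lam k)))) * (ENNReal.ofReal (lam k))⁻¹ ^ 2 := by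
          gcongr
      _ = (∫⁻ x, ψ x) ^ 2 * (ENNReal.ofReal (lam k) * (ENNReal.ofReal (lam k))⁻¹) ^ 2 +
          17 * B * (∫⁻ x, ψ x) * (ENNReal.ofReal (lam k))⁻¹ *
            (ENNReal.ofReal (lam k) * (ENNReal.ofReal (lam k))⁻¹) := by ring
      _ = _ := by rw [ENNReal.mul_inv_cancel (h0 k) (ht k), one_pow, mul_one, mul_one]

/-- A fixed disc with levels up to `lam` has mean count proportional to `lam`, so the probability
that it stays empty tends to zero. Radii `1 / (m + 1)` reduce all `ε` to countably many events. -/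
theorem ae_forall_exists_norm_lt [IsProbabilityMeasure P]
    (hP : IsPoissonPointProcess P Z networkIntensity) :
    ∀ᵐ ω ∂P, ∀ ε : ℝ, 0 < ε → ∃ i, ‖(Z i ω).1‖ < ε := by
  have key : ∀ m : ℕ, ∀ᵐ ω ∂P, ∃ i, ‖(Z i ω).1‖ < 1 / ((m : ℝ) + 1) := by
    intro m
    set r : ℝ := 1 / ((m : ℝ) + 1) with hr
    have hr0 : 0 < r := by positivity
    have hν : ∀ lam : ℝ, networkIntensity (Metric.ball (0 : Plane) r ×ˢ Iic lam) =
        ENNReal.ofReal (r ^ 2 * Real.pi * lam) := by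
      intro lam
      rw [networkIntensity_prod_Iic, EuclideanSpace.volume_ball_fin_two,
        ← ENNReal.ofReal_pow hr0.le, ← ENNReal.ofReal_mul (by positivity),
        ← ENNReal.ofReal_mul (by positivity)]
    have hlim : Tendsto (fun lam : ℝ => r ^ 2 * Real.pi * lam) atTop atTop :=
      tendsto_id.const_mul_atTop (by positivity)
    have hlim2 : Tendsto (fun lam : ℝ => ENNReal.ofReal (Real.exp (-(r ^ 2 * Real.pi * lam / 4))))
        atTop (𝓝 0) := by
      have := ENNReal.tendsto_ofReal (Real.tendsto_exp_neg_atTop_nhds_zero.comp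
        (hlim.atTop_div_const (show (0 : ℝ) < 4 by norm_num)))
      simpa using this
    rw [ae_iff]
    refine le_antisymm (ge_of_tendsto hlim2 ?_) zero_le
    filter_upwards [hlim.eventually_ge_atTop 4] with lam hlam
    have := hP.measure_pointCount_lt (A := Metric.ball (0 : Plane) r ×ˢ Iic lam)
      (measurableSet_ball.prod measurableSet_Iic) (by simp [hν]) (K := 1)
      (by rw [hν, ENNReal.toReal_ofReal (by linarith)]; push_cast; linarith)
    rw [hν, ENNReal.toReal_ofReal (by linarith)] at this
    refine le_trans (measure_mono ?_) this
    intro ω hω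
    simp only [mem_ofPred_eq, not_exists, not_lt] at hω ⊢
    by_contra hcon
    rw [not_lt, le_pointCount_iff] at hcon
    obtain ⟨s, hs, h⟩ := hcon
    obtain ⟨i, hi⟩ : s.Nonempty := Finset.card_pos.1 (by omega)
    have := (h i hi).1
    rw [mem_ball_zero_iff] at this
    exact absurd this (not_lt.2 (hω i))
  filter_upwards [ae_all_iff.2 key] with ω hω ε hε
  obtain ⟨m, hm⟩ := exists_nat_one_div_lt hε
  obtain ⟨i, hi⟩ := hω m
  exact ⟨i, hi.trans hm⟩

end Limits

/-- Interpolation of a limit along the squares by monotonicity. -/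
theorem tendsto_div_of_monotone_of_tendsto_sq {F : ℝ → ℝ≥0∞} (hF : Monotone F) {m : ℝ≥0∞}
    (h : Tendsto (fun k : ℕ => F (((k : ℝ) + 1) ^ 2) / ENNReal.ofReal (((k : ℝ) + 1) ^ 2)) atTop
      (𝓝 m)) :
    Tendsto (fun lam => F lam / ENNReal.ofReal lam) atTop (𝓝 m) := by
  have hratio : Tendsto (fun k : ℕ => ((k : ℝ) + 1) / (k + 2)) atTop (𝓝 1) := by
    have := tendsto_natCast_div_add_atTop (𝕜 := ℝ) (1 : ℝ)
    have h2 := (tendsto_add_atTop_iff_nat 1).2 this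
    refine h2.congr fun k => ?_
    push_cast
    ring
  have hratio2 : Tendsto (fun k : ℕ => ENNReal.ofReal ((((k : ℝ) + 1) / (k + 2)) ^ 2)) atTop
      (𝓝 1) := by
    have := ENNReal.tendsto_ofReal (hratio.pow 2)
    simpa using this
  have hratio3 : Tendsto (fun k : ℕ => (ENNReal.ofReal ((((k : ℝ) + 1) / (k + 2)) ^ 2))⁻¹) atTop
      (𝓝 1) := by
    have := tendsto_inv_iff.2 hratio2
    simpa using this
  have hlow : Tendsto (fun k : ℕ => F (((k : ℝ) + 1) ^ 2) / ENNReal.ofReal (((k : ℝ) + 1) ^ 2) *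
      ENNReal.ofReal ((((k : ℝ) + 1) / (k + 2)) ^ 2)) atTop (𝓝 m) := by
    have := ENNReal.Tendsto.mul h (Or.inr ENNReal.one_ne_top) hratio2 (Or.inl one_ne_zero)
    rwa [mul_one] at this
  have hupp : Tendsto (fun k : ℕ => F ((((k + 1 : ℕ) : ℝ) + 1) ^ 2) /
      ENNReal.ofReal ((((k + 1 : ℕ) : ℝ) + 1) ^ 2) *
      (ENNReal.ofReal ((((k : ℝ) + 1) / (k + 2)) ^ 2))⁻¹) atTop (𝓝 m) := by
    have := ENNReal.Tendsto.mul ((tendsto_add_atTop_iff_nat 1).2 h) (Or.inr ENNReal.one_ne_top)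
      hratio3 (Or.inl one_ne_zero)
    rwa [mul_one] at this
  -- With this `k`, the density lies between `(k + 1)²` and `(k + 2)²`, whose ratio tends to one.
  have hk : Tendsto (fun lam : ℝ => ⌊Real.sqrt lam⌋₊ - 1) atTop atTop :=
    (tendsto_sub_atTop_nat 1).comp
      (tendsto_nat_floor_atTop.comp Real.tendsto_sqrt_atTop)
  have hfl : ∀ lam : ℝ, 1 ≤ lam → ((⌊Real.sqrt lam⌋₊ - 1 : ℕ) : ℝ) + 1 ≤ Real.sqrt lam ∧
      Real.sqrt lam ≤ ((⌊Real.sqrt lam⌋₊ - 1 : ℕ) : ℝ) + 2 := by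
    intro lam hlam
    have h1 : 1 ≤ ⌊Real.sqrt lam⌋₊ := Nat.le_floor (by simpa using Real.one_le_sqrt.2 hlam)
    have h2 := Nat.floor_le (Real.sqrt_nonneg lam)
    have h3 := Nat.lt_floor_add_one (Real.sqrt lam)
    push_cast [Nat.cast_sub h1]
    constructor <;> linarith
  refine tendsto_of_tendsto_of_tendsto_of_le_of_le' (hlow.comp hk) (hupp.comp hk) ?_ ?_
  · filter_upwards [eventually_ge_atTop 1] with lam hlam
    obtain ⟨h1, h2⟩ := hfl lam hlam
    simp only [Function.comp_apply]
    set k := ⌊Real.sqrt lam⌋₊ - 1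
    have hs := Real.sq_sqrt (show 0 ≤ lam by linarith)
    have e1 : ((k : ℝ) + 1) ^ 2 ≤ lam := by rw [← hs]; gcongr
    have e2 : lam ≤ ((k : ℝ) + 2) ^ 2 := by rw [← hs]; gcongr
    have e3 : 0 < ((k : ℝ) + 1) ^ 2 := by positivity
    calc _ = F (((k : ℝ) + 1) ^ 2) * (ENNReal.ofReal (((k : ℝ) + 2) ^ 2))⁻¹ := by
          rw [div_eq_mul_inv, mul_assoc, ← ENNReal.ofReal_inv_of_pos e3,
            ← ENNReal.ofReal_inv_of_pos (by positivity), ← ENNReal.ofReal_mul (by positivity)]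
          congr 2
          field_simp
      _ ≤ F lam * (ENNReal.ofReal lam)⁻¹ := by
          gcongr
          exact hF e1
      _ = _ := (div_eq_mul_inv _ _).symm
  · filter_upwards [eventually_ge_atTop 1] with lam hlam
    obtain ⟨h1, h2⟩ := hfl lam hlam
    simp only [Function.comp_apply]
    set k := ⌊Real.sqrt lam⌋₊ - 1
    have hs := Real.sq_sqrt (show 0 ≤ lam by linarith)
    have e1 : ((k : ℝ) + 1) ^ 2 ≤ lam := by rw [← hs]; gcongr
    have e2 : lam ≤ ((((k + 1 : ℕ) : ℝ)) + 1) ^ 2 := by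
      rw [← hs]
      push_cast
      gcongr
      linarith
    have e3 : 0 < ((k : ℝ) + 1) ^ 2 := by positivity
    calc _ = F lam * (ENNReal.ofReal lam)⁻¹ := div_eq_mul_inv _ _
      _ ≤ F ((((k + 1 : ℕ) : ℝ) + 1) ^ 2) * (ENNReal.ofReal (((k : ℝ) + 1) ^ 2))⁻¹ := by
          gcongr
          exact hF e2
      _ = _ := by
          rw [div_eq_mul_inv, mul_assoc, ← ENNReal.ofReal_inv_of_pos e3,
            ← ENNReal.ofReal_inv_of_pos (by positivity),
            ← ENNReal.ofReal_inv_of_pos (by positivity), ← ENNReal.ofReal_mul (by positivity)]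
          congr 2
          push_cast
          field_simp
          ring

/-- Almost sure convergence and bounded second moments imply convergence of the means. -/
theorem tendsto_integral_of_ae_tendsto_of_sq_le {Ω : Type*} [MeasurableSpace Ω] {P : Measure Ω}
    [IsProbabilityMeasure P] {Y : ℕ → Ω → ℝ} (hY : ∀ k, Measurable (Y k))
    (hnn : ∀ k ω, 0 ≤ Y k ω) {c C : ℝ} (hC : 0 ≤ C)
    (hsq : ∀ k, ∫⁻ ω, ENNReal.ofReal (Y k ω ^ 2) ∂P ≤ ENNReal.ofReal C)
    (hlim : ∀ᵐ ω ∂P, Tendsto (fun k => Y k ω) atTop (𝓝 c)) :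
    Tendsto (fun k => ∫ ω, Y k ω ∂P) atTop (𝓝 c) := by
  have hsqint : ∀ k, Integrable (fun ω => Y k ω ^ 2) P := fun k =>
    (lintegral_ofReal_ne_top_iff_integrable ((hY k).pow_const 2).aestronglyMeasurable
      (ae_of_all _ fun ω => sq_nonneg _)).1 (ne_top_of_le_ne_top ENNReal.ofReal_ne_top (hsq k))
  have hsqle : ∀ k, ∫ ω, Y k ω ^ 2 ∂P ≤ C := by
    intro k
    rw [integral_eq_lintegral_of_nonneg_ae (ae_of_all _ fun ω => sq_nonneg _)
      ((hY k).pow_const 2).aestronglyMeasurable]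
    exact ENNReal.toReal_le_of_le_ofReal hC (hsq k)
  have hint : ∀ k, Integrable (Y k) P := fun k =>
    (memLp_two_iff_integrable_sq (hY k).aestronglyMeasurable).2 (hsqint k) |>.integrable
      one_le_two
  have hmin : ∀ K : ℝ, 0 ≤ K → ∀ k, Integrable (fun ω => min (Y k ω) K) P := fun K hK k =>
    (hint k).mono' ((hY k).min measurable_const).aestronglyMeasurable
      (ae_of_all _ fun ω => by
        rw [Real.norm_of_nonneg (le_min (hnn k ω) hK)]
        exact min_le_left _ _)
  have hminlim : ∀ K : ℝ, 0 ≤ K → c < K →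
      Tendsto (fun k => ∫ ω, min (Y k ω) K ∂P) atTop (𝓝 c) := by
    intro K hK0 hK
    have : Tendsto (fun k => ∫ ω, min (Y k ω) K ∂P) atTop (𝓝 (∫ _ω, c ∂P)) := by
      refine tendsto_integral_of_dominated_convergence (fun _ => K)
        (fun k => (hmin K hK0 k).aestronglyMeasurable) (integrable_const K) (fun k => ?_) ?_
      · refine ae_of_all _ fun ω => ?_
        rw [Real.norm_of_nonneg (le_min (hnn k ω) hK0)]
        exact min_le_right _ _
      · filter_upwards [hlim] with ω hω
        have := hω.min (tendsto_const_nhds (x := K))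
        rwa [min_eq_left hK.le] at this
    simpa using this
  -- Truncation by `x ≤ min x K + x² / K`: the truncated means converge by dominated convergence,
  -- and the second-moment bound makes the remainder small uniformly in `k`.
  have hdiff : ∀ K : ℝ, 0 < K → ∀ k, ∫ ω, Y k ω ∂P ≤ (∫ ω, min (Y k ω) K ∂P) + C / K := by
    intro K hK k
    calc ∫ ω, Y k ω ∂P ≤ ∫ ω, (min (Y k ω) K + Y k ω ^ 2 / K) ∂P := by
          refine integral_mono (hint k) ((hmin K hK.le k).add ((hsqint k).div_const K)) fun ω => ?_
          dsimp only
          have h0 := hnn k ω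
          rcases le_total (Y k ω) K with h | h
          · rw [min_eq_left h]
            have : 0 ≤ Y k ω ^ 2 / K := by positivity
            linarith
          · rw [min_eq_right h]
            have : Y k ω ≤ Y k ω ^ 2 / K := by
              rw [le_div_iff₀ hK]
              nlinarith
            linarith
      _ = (∫ ω, min (Y k ω) K ∂P) + (∫ ω, Y k ω ^ 2 ∂P) / K := by
          rw [integral_add (hmin K hK.le k) ((hsqint k).div_const K), integral_div]
      _ ≤ _ := by gcongr; exact hsqle k
  rw [tendsto_order]
  constructor
  · intro a ha
    filter_upwards [(hminlim (|c| + 1) (by positivity)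
      (by linarith [le_abs_self c])).eventually (lt_mem_nhds ha)] with k hk
    exact hk.trans_le (integral_mono (hmin _ (by positivity) k) (hint k) fun ω => min_le_left _ _)
  · intro a ha
    obtain ⟨K, hK0, hKc, hK⟩ : ∃ K : ℝ, 0 < K ∧ c < K ∧ c < a - C / K := by
      have h1 : Tendsto (fun K : ℝ => a - C / K) atTop (𝓝 (a - 0)) :=
        tendsto_const_nhds.sub (tendsto_const_nhds.div_atTop tendsto_id)
      rw [sub_zero] at h1
      obtain ⟨K, h⟩ := ((eventually_gt_atTop 0).and ((eventually_gt_atTop c).and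
        (h1.eventually (lt_mem_nhds ha)))).exists
      exact ⟨K, h.1, h.2.1, h.2.2⟩
    filter_upwards [(hminlim K hK0.le hKc).eventually (gt_mem_nhds hK)] with k hk
    linarith [hdiff K hK0 k]

/-! ### The path loss integrated over the plane -/

/-- The path loss seen from the origin, of the points at distance at least `ε`. -/
def farLoss (L : ℝ → ℝ) (ε : ℝ) : Plane → ℝ≥0∞ :=
  {x | ε ≤ ‖x‖}.indicator fun x => ENNReal.ofReal (L ‖x‖)

theorem measurable_farLoss {L : ℝ → ℝ} (hL : Measurable L) (ε : ℝ) : Measurable (farLoss L ε) :=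
  Measurable.indicator (by fun_prop) (measurableSet_le measurable_const (by fun_prop))

theorem farLoss_le {L : ℝ → ℝ} (hL : PhysicallyFeasible L) (ε : ℝ) (x : Plane) :
    farLoss L ε x ≤ ENNReal.ofReal (L 0) :=
  (indicator_le_self _ _ x).trans (ENNReal.ofReal_le_ofReal (hL.le_zero _ (norm_nonneg x)))

theorem farLoss_zero (L : ℝ → ℝ) : farLoss L 0 = fun x => ENNReal.ofReal (L ‖x‖) := by
  ext x
  simp [farLoss]

theorem lintegral_farLoss_zero {L : ℝ → ℝ} (hL : PhysicallyFeasible L) :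
    ∫⁻ x, farLoss L 0 x = ENNReal.ofReal (2 * Real.pi * pathLossGamma L) := by
  have hint : Integrable (fun x : Plane => L ‖x‖) := by
    rw [integrable_fun_norm_addHaar (volume : Measure Plane) (f := L)]
    simpa using hL.integrable
  have h := integral_fun_norm_addHaar (volume : Measure Plane) L
  rw [farLoss_zero, ← ofReal_integral_eq_lintegral_ofReal hint
    (ae_of_all _ fun x => hL.nonneg _ (norm_nonneg x)), h, pathLossGamma, measureReal_def,
    EuclideanSpace.volume_ball_fin_two]
  congr 1
  simp [Real.pi_pos.le]
  ring

theorem lintegral_farLoss_le {L : ℝ → ℝ} (ε : ℝ) :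
    ∫⁻ x, farLoss L ε x ≤ ∫⁻ x, farLoss L 0 x := by
  refine lintegral_mono fun x => ?_
  rw [farLoss_zero]
  exact indicator_le_self _ _ x

/-- Monotone convergence: only the origin, a null set, is never reached by the shrinking radii. -/
theorem tendsto_lintegral_farLoss {L : ℝ → ℝ} (hL : Measurable L) :
    Tendsto (fun m : ℕ => ∫⁻ x, farLoss L (1 / ((m : ℝ) + 1)) x) atTop
      (𝓝 (∫⁻ x, farLoss L 0 x)) := by
  refine lintegral_tendsto_of_tendsto_of_monotone
    (fun m => (measurable_farLoss hL _).aemeasurable) (ae_of_all _ fun x => ?_) ?_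
  · intro a b hab
    refine indicator_le_indicator_of_subset ?_ (fun _ => zero_le) x
    intro x hx
    have : (a : ℝ) ≤ b := by exact_mod_cast hab
    exact le_trans (by gcongr) (show 1 / ((a : ℝ) + 1) ≤ ‖x‖ from hx)
  · have h0 : ∀ᵐ x : Plane, x ≠ 0 := by
      rw [ae_iff]
      simp
    filter_upwards [h0] with x hx
    refine tendsto_const_nhds.congr' ?_
    have hpos : 0 < ‖x‖ := norm_pos_iff.2 hx
    filter_upwards [tendsto_one_div_add_atTop_nhds_zero_nat.eventually (gt_mem_nhds hpos)]
      with m hm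
    rw [farLoss_zero, farLoss, indicator_of_mem]
    exact hm.le

/-! ### The scaled signal-to-interference-and-noise ratio along a realization -/

theorem totalInterference_le_levelSum (L : ℝ → ℝ) (lam : ℝ) (z : ℕ → Plane × ℝ) (y : ℕ → ℝ) :
    totalInterference L lam z y ≤ levelSum (farLoss L 0) lam z y := by
  refine ENNReal.tsum_le_tsum fun i => ?_
  rw [farLoss_zero]
  split_ifs with h1 h2 h2
  · exact le_rfl
  · exact absurd h1.1 h2
  · exact zero_le
  · exact zero_le

theorem levelSum_le_totalInterference (L : ℝ → ℝ) {ε lam : ℝ} {z : ℕ → Plane × ℝ} (y : ℕ → ℝ)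
    (h : nearestDist lam z < ε) :
    levelSum (farLoss L ε) lam z y ≤ totalInterference L lam z y := by
  refine ENNReal.tsum_le_tsum fun i => ?_
  split_ifs with h1 h2 h2
  · gcongr
    exact indicator_le_self _ _ _
  · rw [farLoss, indicator_of_notMem, zero_mul]
    exact fun h3 => h2 ⟨h1, h.trans_le h3⟩
  · exact absurd h2.1 h1
  · simp

theorem tendsto_nearestDist {z : ℕ → Plane × ℝ} (hz : ∀ ε : ℝ, 0 < ε → ∃ i, ‖(z i).1‖ < ε) :
    Tendsto (fun lam => nearestDist lam z) atTop (𝓝 0) := by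
  rw [tendsto_order]
  refine ⟨fun a ha => Eventually.of_forall fun lam => ha.trans_le (nearestDist_nonneg lam z),
    fun a ha => ?_⟩
  obtain ⟨i, hi⟩ := hz a ha
  filter_upwards [eventually_ge_atTop (z i).2] with lam hlam
  exact (nearestDist_le hlam).trans_lt hi

/-- The gain of the nearest point without fading, divided by interference plus noise. -/
def lossRatio (L : ℝ → ℝ) (noise lam : ℝ) (z : ℕ → Plane × ℝ) (y : ℕ → ℝ) : ℝ :=
  L (nearestDist lam z) / ((totalInterference L lam z y).toReal + noise)

theorem lossRatio_nonneg {L : ℝ → ℝ} (hL : PhysicallyFeasible L) {noise : ℝ} (hn : 0 ≤ noise)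
    (lam : ℝ) (z : ℕ → Plane × ℝ) (y : ℕ → ℝ) : 0 ≤ lossRatio L noise lam z y :=
  div_nonneg (hL.nonneg _ (nearestDist_nonneg lam z)) (by positivity)

theorem measurable_lossRatio {L : ℝ → ℝ} (hL : Measurable L) (noise lam : ℝ) :
    Measurable fun p : (ℕ → Plane × ℝ) × (ℕ → ℝ) => lossRatio L noise lam p.1 p.2 := by
  have h1 := measurable_nearestDist lam
  have h2 := measurable_totalInterference hL lam
  unfold lossRatio
  fun_prop

/-- A deterministic statement for one realization. The nearest distance eventually falls below any
`1 / (m + 1)`, which sandwiches the interference between far and full sums; countably many radii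
suffice for the lower bound. -/
theorem tendsto_mul_lossRatio {ι : Type*} {l : Filter ι} {L : ℝ → ℝ} (hL : PhysicallyFeasible L)
    (noise : ℝ) {lam : ι → ℝ} (hlam : Tendsto lam l atTop) {z : ℕ → Plane × ℝ}
    {y : ι → ℕ → ℝ} (hz : ∀ ε : ℝ, 0 < ε → ∃ i, ‖(z i).1‖ < ε)
    (h0 : Tendsto (fun k => levelSum (farLoss L 0) (lam k) z (y k) / ENNReal.ofReal (lam k)) l
      (𝓝 (∫⁻ x, farLoss L 0 x)))
    (hε : ∀ m : ℕ, Tendsto (fun k => levelSum (farLoss L (1 / ((m : ℝ) + 1))) (lam k) z (y k) /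
      ENNReal.ofReal (lam k)) l (𝓝 (∫⁻ x, farLoss L (1 / ((m : ℝ) + 1)) x))) :
    Tendsto (fun k => lam k * lossRatio L noise (lam k) z (y k)) l
      (𝓝 (L 0 / (2 * Real.pi * pathLossGamma L))) := by
  have hγ : 0 < pathLossGamma L := hL.integral_pos
  have hdist : Tendsto (fun k => nearestDist (lam k) z) l (𝓝 0) := (tendsto_nearestDist hz).comp hlam
  have hI : Tendsto (fun k => totalInterference L (lam k) z (y k) / ENNReal.ofReal (lam k)) l
      (𝓝 (∫⁻ x, farLoss L 0 x)) := by
    rw [tendsto_order]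
    constructor
    · intro a ha
      obtain ⟨m, hm⟩ :=
        ((tendsto_lintegral_farLoss hL.measurable).eventually (lt_mem_nhds ha)).exists
      filter_upwards [(hε m).eventually (lt_mem_nhds hm),
        hdist.eventually (gt_mem_nhds (show (0 : ℝ) < 1 / ((m : ℝ) + 1) by positivity))]
        with k h1 h2
      refine h1.trans_le ?_
      gcongr
      exact levelSum_le_totalInterference L (y k) h2
    · intro a ha
      filter_upwards [h0.eventually (gt_mem_nhds ha)] with k h1
      refine lt_of_le_of_lt ?_ h1
      gcongr
      exact totalInterference_le_levelSum L (lam k) z (y k)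
  rw [lintegral_farLoss_zero hL] at hI
  have hI' : Tendsto (fun k => (totalInterference L (lam k) z (y k)).toReal / lam k) l
      (𝓝 (2 * Real.pi * pathLossGamma L)) := by
    have := (ENNReal.tendsto_toReal ENNReal.ofReal_ne_top).comp hI
    rw [ENNReal.toReal_ofReal (by positivity)] at this
    refine this.congr' ?_
    filter_upwards [hlam.eventually_ge_atTop 0] with k hk
    rw [Function.comp_apply, ENNReal.toReal_div, ENNReal.toReal_ofReal hk]
  have hnoise : Tendsto (fun k => noise / lam k) l (𝓝 0) := tendsto_const_nhds.div_atTop hlam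
  have hLd : Tendsto (fun k => L (nearestDist (lam k) z)) l (𝓝 (L 0)) :=
    hL.continuous_zero.tendsto.comp (tendsto_nhdsWithin_iff.2
      ⟨hdist, Eventually.of_forall fun k => nearestDist_nonneg _ _⟩)
  have hfin := hLd.div (hI'.add hnoise) (by positivity)
  rw [add_zero] at hfin
  refine hfin.congr' ?_
  filter_upwards [hlam.eventually_gt_atTop 0] with k hk
  rw [Pi.div_apply, lossRatio, ← add_div, div_div_eq_mul_div, mul_comm, mul_div_assoc]

/-! ### The downlink SINR -/

namespace MISONetwork

variable {Ω : Type*} [MeasurableSpace Ω] {P : Measure Ω} (X : MISONetwork P)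

theorem sinr_eq {L : ℝ → ℝ} (hL : PhysicallyFeasible L) (Nt : ℝ → ℕ) (noise lam : ℝ) (ω : Ω) :
    X.sinr L Nt noise lam ω = X.servGain (Nt lam) ω *
      lossRatio L noise lam (fun i => X.point i ω) (fun i => X.crossGain (Nt lam) i ω) := by
  classical
  have h : X.interference L (Nt lam) lam ω = (totalInterference L lam (fun i => X.point i ω)
      (fun i => X.crossGain (Nt lam) i ω)).toReal := by
    -- This holds even for a divergent sum: the real `tsum` and `toReal ∞` both default to zero.
    rw [totalInterference, ENNReal.tsum_toReal_eq, interference]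
    · congr with i
      split_ifs with h1 h2 h2
      · rw [ENNReal.toReal_mul, ENNReal.toReal_ofReal (hL.nonneg _ (norm_nonneg _)),
          ENNReal.toReal_ofReal (X.crossGain_nonneg _ _ _)]
      · exact absurd h1 h2
      · exact absurd h2 h1
      · rfl
    · intro i
      split_ifs <;> finiteness
  rw [sinr, h, lossRatio]
  change L (nearestDist lam fun i => X.point i ω) * _ / _ = _
  ring

variable {X}

/-- Fixed gains allow the marks for one antenna to be used at every density. The level sums are then
monotone in `lam`, and the squares, with summable reciprocals, determine the limit. -/
theorem MeasurableFading.ae_tendsto_sinr [IsProbabilityMeasure P] (hX : X.MeasurableFading)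
    {L : ℝ → ℝ} (hL : PhysicallyFeasible L) {Nt : ℝ → ℕ} (hNt : Tendsto Nt atTop atTop)
    (noise : ℝ) (hfix : X.FixedInterfererGains) :
    ∀ᵐ ω ∂P, Tendsto (fun lam : ℝ => lam / (Nt lam : ℝ) * X.sinr L Nt noise lam ω) atTop
      (𝓝 (L 0 / (2 * Real.pi * pathLossGamma L))) := by
  have hsum : ∑' k : ℕ, (ENNReal.ofReal (((k : ℝ) + 1) ^ 2))⁻¹ ≠ ∞ := by
    have h1 : Summable fun k : ℕ => (((k : ℝ) + 1) ^ 2)⁻¹ := by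
      have := (summable_nat_add_iff 1).2 (Real.summable_nat_pow_inv.2 one_lt_two)
      exact_mod_cast this
    have h2 := h1.tsum_ofReal_ne_top
    convert h2 using 3 with k
    rw [ENNReal.ofReal_inv_of_pos (by positivity)]
  have hlim : ∀ ε, ∀ᵐ ω ∂P, Tendsto (fun lam => levelSum (farLoss L ε) lam
      (fun i => X.point i ω) (fun i => X.crossGain 1 i ω) / ENNReal.ofReal lam) atTop
      (𝓝 (∫⁻ x, farLoss L ε x)) := by
    intro ε
    have h := ae_tendsto_levelSum_div X.poisson (g := fun _ => X.crossGain 1)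
      (fun _ => hX.isExpMarking le_rfl) (measurable_farLoss hL.measurable ε)
      ENNReal.ofReal_ne_top (farLoss_le hL ε)
      (ne_top_of_le_ne_top (by rw [lintegral_farLoss_zero hL]; exact ENNReal.ofReal_ne_top)
        (lintegral_farLoss_le ε))
      (lam := fun k => ((k : ℝ) + 1) ^ 2) (fun k => by positivity) hsum
    filter_upwards [h] with ω hω
    exact tendsto_div_of_monotone_of_tendsto_sq (levelSum_mono _ _ _) hω
  filter_upwards [hlim 0, ae_all_iff.2 fun m : ℕ => hlim (1 / ((m : ℝ) + 1)),
    ae_forall_exists_norm_lt X.poisson, hX.ae_tendsto_servGain_div, hfix] with ω h0 hε hz hs hf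
  have h1 : Tendsto (fun lam => lam * lossRatio L noise lam (fun i => X.point i ω)
      (fun i => X.crossGain 1 i ω)) atTop (𝓝 (L 0 / (2 * Real.pi * pathLossGamma L))) :=
    tendsto_mul_lossRatio (lam := fun lam => lam) (y := fun _ i => X.crossGain 1 i ω)
      hL noise tendsto_id hz h0 hε
  have h2 := (hs.comp hNt).mul h1
  rw [one_mul] at h2
  refine h2.congr' ?_
  filter_upwards [hNt.eventually_ge_atTop 1] with lam hlam
  have h3 : (fun i => X.crossGain (Nt lam) i ω) = fun i => X.crossGain 1 i ω :=
    funext fun i => hf _ _ hlam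
  rw [X.sinr_eq hL, h3, Function.comp_apply]
  ring

theorem MeasurableFading.lintegral_sinr [IsProbabilityMeasure P] (hX : X.MeasurableFading)
    {L : ℝ → ℝ} (hL : PhysicallyFeasible L) (Nt : ℝ → ℕ) (noise lam : ℝ) :
    ∫⁻ ω, ENNReal.ofReal (X.sinr L Nt noise lam ω) ∂P = Nt lam * ∫⁻ ω, ENNReal.ofReal
      (lossRatio L noise lam (fun i => X.point i ω) (fun i => X.crossGain (Nt lam) i ω)) ∂P := by
  rw [← hX.lintegral_servGain_mul (Nt lam)
    (F := fun p => ENNReal.ofReal (lossRatio L noise lam p.1 p.2))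
    (measurable_lossRatio hL.measurable noise lam).ennreal_ofReal]
  congr with ω
  rw [X.sinr_eq hL, ENNReal.ofReal_mul (X.servGain_nonneg _ _)]

theorem MeasurableFading.measurable_lossRatio (hX : X.MeasurableFading)
    {L : ℝ → ℝ} (hL : Measurable L) (noise lam : ℝ) (n : ℕ) :
    Measurable fun ω => lossRatio L noise lam (fun i => X.point i ω)
      (fun i => X.crossGain n i ω) := by
  have h1 : Measurable fun ω i => X.point i ω := measurable_pi_lambda _ X.measurable_point
  have h2 : Measurable fun ω i => X.crossGain n i ω := measurable_pi_lambda _ (hX.crossGain n)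
  have h3 := (_root_.measurable_lossRatio hL noise lam).comp (h1.prodMk h2)
  exact h3

theorem MeasurableFading.measurable_sinr [IsProbabilityMeasure P] (hX : X.MeasurableFading)
    {L : ℝ → ℝ} (hL : PhysicallyFeasible L) (Nt : ℝ → ℕ) (noise lam : ℝ) :
    Measurable (X.sinr L Nt noise lam) := by
  rw [funext (X.sinr_eq hL Nt noise lam)]
  exact (hX.servGain _).mul (hX.measurable_lossRatio hL.measurable noise lam _)

theorem sinr_nonneg {L : ℝ → ℝ} (hL : PhysicallyFeasible L) (Nt : ℝ → ℕ) {noise : ℝ}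
    (hn : 0 ≤ noise) (lam : ℝ) (ω : Ω) : 0 ≤ X.sinr L Nt noise lam ω := by
  rw [X.sinr_eq hL]
  exact mul_nonneg (X.servGain_nonneg _ _) (lossRatio_nonneg hL hn _ _ _)

/-- The scaled ratios have uniformly bounded second moments. -/
theorem MeasurableFading.exists_lintegral_sq_lossRatio_le [IsProbabilityMeasure P]
    (hX : X.MeasurableFading) {L : ℝ → ℝ} (hL : PhysicallyFeasible L) (hT : PathLossTail L)
    {noise : ℝ} (hn : 0 ≤ noise) :
    ∃ C : ℝ, 0 ≤ C ∧ ∀ᶠ lam : ℝ in atTop, ∀ n : ℕ, 1 ≤ n → ∫⁻ ω, ENNReal.ofReal ((lam *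
      lossRatio L noise lam (fun i => X.point i ω) (fun i => X.crossGain n i ω)) ^ 2) ∂P ≤
        ENNReal.ofReal C := by
  obtain ⟨C, hC, hle⟩ := exists_lintegral_inv_sq_totalInterference_le X.poisson hL hT
  have hL0 := hL.zero_pos
  refine ⟨L 0 ^ 2 * C, by positivity, ?_⟩
  filter_upwards [hle, eventually_gt_atTop 0] with lam hle hlam n hnn
  have hg := hX.isExpMarking hnn
  -- Infinite interference would become zero under `toReal` and spoil the comparison with the
  -- inverse square; its finite mean excludes this almost surely.
  have hfin : ∀ᵐ ω ∂P, totalInterference L lam (fun i => X.point i ω)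
      (fun i => X.crossGain n i ω) < ∞ := by
    have h1 := lintegral_levelSum X.poisson hg (measurable_farLoss hL.measurable 0) lam
    have h2 := ae_lt_top (measurable_levelSum X.poisson hg.measurable
      (measurable_farLoss hL.measurable 0) lam)
      (by rw [h1, lintegral_farLoss_zero hL]; finiteness)
    filter_upwards [h2] with ω hω
    exact (totalInterference_le_levelSum L lam _ _).trans_lt hω
  calc _ ≤ ∫⁻ ω, ENNReal.ofReal ((lam * L 0) ^ 2) * (totalInterference L lam
        (fun i => X.point i ω) (fun i => X.crossGain n i ω) ^ 2)⁻¹ ∂P := by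
        refine lintegral_mono_ae ?_
        filter_upwards [hfin] with ω hω
        set I := totalInterference L lam (fun i => X.point i ω) (fun i => X.crossGain n i ω) with hI
        rcases eq_or_ne I 0 with h0 | h0
        · rw [h0]
          rw [zero_pow two_ne_zero, ENNReal.inv_zero, ENNReal.mul_top]
          · exact le_top
          · exact (ENNReal.ofReal_pos.2 (by positivity)).ne'
        · have hpos : 0 < I.toReal := ENNReal.toReal_pos h0 hω.ne
          have hIr : I = ENNReal.ofReal I.toReal := (ENNReal.ofReal_toReal hω.ne).symm
          rw [hIr, ← ENNReal.ofReal_pow hpos.le, ← ENNReal.ofReal_inv_of_pos (by positivity),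
            ← ENNReal.ofReal_mul (by positivity)]
          apply ENNReal.ofReal_le_ofReal
          rw [← inv_pow, ← mul_pow, mul_assoc, ← div_eq_mul_inv]
          have hr0 := lossRatio_nonneg hL hn lam (fun i => X.point i ω)
            (fun i => X.crossGain n i ω)
          gcongr
          rw [lossRatio, ← hI]
          gcongr
          · exact hL.le_zero _ (nearestDist_nonneg _ _)
          · linarith
    _ ≤ ENNReal.ofReal ((lam * L 0) ^ 2) * ENNReal.ofReal (C / lam ^ 2) := by
        rw [lintegral_const_mul' _ _ ENNReal.ofReal_ne_top]
        exact mul_le_mul_right (hle _ hg) _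
    _ = _ := by
        rw [← ENNReal.ofReal_mul (by positivity)]
        congr 1
        field_simp

/-- It is enough to treat subsequences. One with `u (φ k) ≥ (k + 1)²` has summable reciprocals,
hence almost sure convergence, and the uniform second-moment bound carries the limit to the means.
-/
theorem MeasurableFading.tendsto_mul_integral_lossRatio [IsProbabilityMeasure P]
    (hX : X.MeasurableFading) {L : ℝ → ℝ} (hL : PhysicallyFeasible L) (hT : PathLossTail L)
    {Nt : ℝ → ℕ} (hNt : Tendsto Nt atTop atTop) {noise : ℝ} (hn : 0 ≤ noise) :
    Tendsto (fun lam : ℝ => ∫ ω, lam * lossRatio L noise lam (fun i => X.point i ω)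
      (fun i => X.crossGain (Nt lam) i ω) ∂P) atTop
      (𝓝 (L 0 / (2 * Real.pi * pathLossGamma L))) := by
  obtain ⟨C, hC, hle⟩ := hX.exists_lintegral_sq_lossRatio_le hL hT hn
  refine tendsto_of_subseq_tendsto fun u hu => ?_
  have hev : ∀ k : ℕ, ∀ᶠ j in atTop, ((k : ℝ) + 1) ^ 2 ≤ u j ∧ 1 ≤ Nt (u j) ∧
      ∀ n : ℕ, 1 ≤ n → ∫⁻ ω, ENNReal.ofReal ((u j * lossRatio L noise (u j)
        (fun i => X.point i ω) (fun i => X.crossGain n i ω)) ^ 2) ∂P ≤ ENNReal.ofReal C := fun k =>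
    (hu.eventually_ge_atTop _).and (((hNt.comp hu).eventually_ge_atTop 1).and (hu.eventually hle))
  obtain ⟨φ, hφ, hgood⟩ := extraction_forall_of_eventually hev
  refine ⟨φ, ?_⟩
  have hpos : ∀ k, 0 < u (φ k) := fun k => lt_of_lt_of_le (by positivity) (hgood k).1
  have hsum : ∑' k : ℕ, (ENNReal.ofReal (u (φ k)))⁻¹ ≠ ∞ := by
    have h1 : Summable fun k : ℕ => (((k : ℝ) + 1) ^ 2)⁻¹ := by
      have := (summable_nat_add_iff 1).2 (Real.summable_nat_pow_inv.2 one_lt_two)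
      exact_mod_cast this
    refine ne_top_of_le_ne_top h1.tsum_ofReal_ne_top (ENNReal.tsum_le_tsum fun k => ?_)
    rw [ENNReal.ofReal_inv_of_pos (by positivity)]
    exact ENNReal.inv_le_inv.2 (ENNReal.ofReal_le_ofReal (hgood k).1)
  have hlim : ∀ ε, ∀ᵐ ω ∂P, Tendsto (fun k => levelSum (farLoss L ε) (u (φ k))
      (fun i => X.point i ω) (fun i => X.crossGain (Nt (u (φ k))) i ω) /
        ENNReal.ofReal (u (φ k))) atTop (𝓝 (∫⁻ x, farLoss L ε x)) := fun ε =>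
    ae_tendsto_levelSum_div X.poisson (g := fun k => X.crossGain (Nt (u (φ k))))
      (fun k => hX.isExpMarking (hgood k).2.1) (measurable_farLoss hL.measurable ε)
      ENNReal.ofReal_ne_top (farLoss_le hL ε)
      (ne_top_of_le_ne_top (by rw [lintegral_farLoss_zero hL]; exact ENNReal.ofReal_ne_top)
        (lintegral_farLoss_le ε)) hpos hsum
  refine tendsto_integral_of_ae_tendsto_of_sq_le
    (fun k => (hX.measurable_lossRatio hL.measurable noise _ _).const_mul _)
    (fun k ω => mul_nonneg (hpos k).le (lossRatio_nonneg hL hn _ _ _)) hC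
    (fun k => (hgood k).2.2 _ (hgood k).2.1) ?_
  filter_upwards [hlim 0, ae_all_iff.2 fun m : ℕ => hlim (1 / ((m : ℝ) + 1)),
    ae_forall_exists_norm_lt X.poisson] with ω h0 hε hz
  exact tendsto_mul_lossRatio hL noise (hu.comp hφ.tendsto_atTop) hz h0 hε

theorem MeasurableFading.eventually_integrable_sinr [IsProbabilityMeasure P]
    (hX : X.MeasurableFading) {L : ℝ → ℝ} (hL : PhysicallyFeasible L) (hT : PathLossTail L)
    {Nt : ℝ → ℕ} (hNt : Tendsto Nt atTop atTop) {noise : ℝ} (hn : 0 ≤ noise) :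
    ∀ᶠ lam : ℝ in atTop, Integrable (X.sinr L Nt noise lam) P := by
  obtain ⟨C, hC, hle⟩ := hX.exists_lintegral_sq_lossRatio_le hL hT hn
  filter_upwards [hle, hNt.eventually_ge_atTop 1, eventually_ge_atTop 1] with lam hle hnn hlam
  refine (lintegral_ofReal_ne_top_iff_integrable
    (hX.measurable_sinr hL Nt noise lam).aestronglyMeasurable
    (ae_of_all _ fun ω => sinr_nonneg hL Nt hn lam ω)).1 ?_
  rw [hX.lintegral_sinr hL]
  refine ENNReal.mul_ne_top (by simp) (ne_top_of_le_ne_top (b := 1 + ENNReal.ofReal C)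
    (by finiteness) ?_)
  calc _ ≤ ∫⁻ ω, (1 + ENNReal.ofReal ((lam * lossRatio L noise lam (fun i => X.point i ω)
        (fun i => X.crossGain (Nt lam) i ω)) ^ 2)) ∂P := by
        refine lintegral_mono fun ω => ?_
        dsimp only
        rw [← ENNReal.ofReal_one, ← ENNReal.ofReal_add zero_le_one (sq_nonneg _)]
        apply ENNReal.ofReal_le_ofReal
        have h0 := lossRatio_nonneg hL hn lam (fun i => X.point i ω)
          (fun i => X.crossGain (Nt lam) i ω)
        set R := lossRatio L noise lam (fun i => X.point i ω)
          (fun i => X.crossGain (Nt lam) i ω)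
        have h1 : R ≤ lam * R := by nlinarith
        -- `R ≤ lam R ≤ 1 + (lam R)²`, so the second-moment bound also gives integrability.
        nlinarith [sq_nonneg (lam * R - 1)]
    _ ≤ _ := by
        rw [lintegral_add_left measurable_const, lintegral_one, measure_univ]
        gcongr
        exact hle _ hnn

theorem MeasurableFading.tendsto_mul_integral_sinr [IsProbabilityMeasure P]
    (hX : X.MeasurableFading) {L : ℝ → ℝ} (hL : PhysicallyFeasible L) (hT : PathLossTail L)
    {Nt : ℝ → ℕ} (hNt : Tendsto Nt atTop atTop) {noise : ℝ} (hn : 0 ≤ noise) :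
    Tendsto (fun lam : ℝ => lam / (Nt lam : ℝ) * ∫ ω, X.sinr L Nt noise lam ω ∂P) atTop
      (𝓝 (L 0 / (2 * Real.pi * pathLossGamma L))) := by
  refine (hX.tendsto_mul_integral_lossRatio hL hT hNt hn).congr' ?_
  filter_upwards [hNt.eventually_ge_atTop 1] with lam hnn
  have h1 : ((Nt lam : ℕ) : ℝ) ≠ 0 := by
    have : Nt lam ≠ 0 := by omega
    exact_mod_cast this
  rw [integral_const_mul, integral_eq_lintegral_of_nonneg_ae
    (ae_of_all _ fun ω => lossRatio_nonneg hL hn _ _ _)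
    (hX.measurable_lossRatio hL.measurable noise lam _).aestronglyMeasurable,
    integral_eq_lintegral_of_nonneg_ae (ae_of_all _ fun ω => sinr_nonneg hL Nt hn lam ω)
    (hX.measurable_sinr hL Nt noise lam).aestronglyMeasurable, hX.lintegral_sinr hL,
    ENNReal.toReal_mul, ENNReal.toReal_natCast]
  field_simp

end MISONetwork

theorem theorem1 {Ω : Type*} [MeasurableSpace Ω] (P : Measure Ω) [IsProbabilityMeasure P]
    (X : MISONetwork P) (L : ℝ → ℝ) (hL : PhysicallyFeasible L) (hT : PathLossTail L)
    (Nt : ℝ → ℕ) (hNt : Tendsto Nt atTop atTop) (noise : ℝ) (hnoise : 0 ≤ noise) :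
    (X.FixedInterfererGains →
      ∀ᵐ ω ∂P, Tendsto (fun lam : ℝ => lam / (Nt lam : ℝ) * X.sinr L Nt noise lam ω) atTop
        (𝓝 (L 0 / (2 * Real.pi * pathLossGamma L)))) ∧
    (∀ᶠ lam : ℝ in atTop, Integrable (X.sinr L Nt noise lam) P) ∧
    Tendsto (fun lam : ℝ => lam / (Nt lam : ℝ) * ∫ ω, X.sinr L Nt noise lam ω ∂P) atTop
      (𝓝 (L 0 / (2 * Real.pi * pathLossGamma L))) := by
  obtain ⟨Y, hY, hpos, hlevel, hae⟩ := X.exists_measurableFading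
  have hgain : ∀ᵐ ω ∂P, (∀ n, Y.servGain n ω = X.servGain n ω) ∧
      ∀ n i, Y.crossGain n i ω = X.crossGain n i ω := by
    filter_upwards [hae] with ω ⟨h1, h2, h3⟩
    refine ⟨fun n => ?_, fun n i => ?_⟩
    · simp only [MISONetwork.servGain, h1]
    · simp only [MISONetwork.crossGain, h2, h3]
  -- The exceptional null set does not depend on `lam`, as the almost sure limit over the
  -- uncountable family of densities requires.
  have hsinr : ∀ᵐ ω ∂P, ∀ lam, Y.sinr L Nt noise lam ω = X.sinr L Nt noise lam ω := by
    filter_upwards [hgain] with ω ⟨h1, h2⟩ lam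
    simp only [MISONetwork.sinr, MISONetwork.interference, MISONetwork.servingDist, hpos, hlevel,
      h1, h2]
    rfl
  have hsinr' : ∀ lam, Y.sinr L Nt noise lam =ᵐ[P] X.sinr L Nt noise lam := fun lam =>
    hsinr.mono fun ω hω => hω lam
  refine ⟨fun hfix => ?_, ?_, ?_⟩
  · have hfix' : Y.FixedInterfererGains := by
      filter_upwards [hfix, hgain] with ω h1 ⟨_, h2⟩ n i hn
      rw [h2, h2, h1 n i hn]
    filter_upwards [hY.ae_tendsto_sinr hL hNt noise hfix', hsinr] with ω h1 h2
    simpa only [h2] using h1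
  · exact (hY.eventually_integrable_sinr hL hT hNt hnoise).mono fun lam h => h.congr (hsinr' lam)
  · simpa only [integral_congr_ae (hsinr' _)] using hY.tendsto_mul_integral_sinr hL hT hNt hnoise

end
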